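/- Let $n\ge 2$, let $\beta_1<\alpha_1<\beta_2<\alpha_2<\cdots<\beta_n<\alpha_n$ be real numbers, let $\Omega=\mathbb{R}\setminus\bigcup_{k=1}^{n}[\beta_k,\alpha_k]$, and let $\ell_k=\beta_{k+1}-\alpha_k$ $(1\le k\le n-1)$ be the lengths of the bounded components $(\alpha_k,\beta_{k+1})$ of $\Omega$. For a unitary $n\times n$ matrix $B$ let $P_B=\frac{1}{2\pi i}\frac{d}{dx}$ be the selfadjoint operator in $L^2(\Omega)$ whose domain consists of all $f\in L^2(\Omega)$ that are absolutely continuous up to the boundary on each component of $\Omega$ (on every compact interval contained in $\overline{\Omega}$), satisfy $f'\in L^2(\Omega)$, and satisfy the boundary condition $B\,(f(\beta_1),\dots,f(\beta_n))^{T}=(f(\alpha_1),\dots,f(\alpha_n))^{T}$, where $f(\beta_k)$ and $f(\alpha_k)$ are the one-sided boundary values from inside $\Omega$. The discrete spectrum of $P_B$ is the set of all its eigenvalues, the multiplicity of an eigenvalue is the dimension of its eigenspace, and the continuous spectrum of $P_B$ is the spectrum of the part of $P_B$ in the orthogonal complement of the span of its eigenvectors. Let $B=\begin{pmatrix}0&I_{n-1}\\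 c&0\end{pmatrix}$ with $c\in\mathbb{C}$, $|c|=1$. Then: 1. the continuous spectrum of $P_B$ is $\mathbb{R}$; 2. the discrete spectrum of $P_B$ is $\bigcup_{k=1}^{n-1}\frac{1}{\ell_k}\mathbb{Z}$; 3. the multiplicity of each eigenvalue $\lambda$ is $\#\{1\le k\le n-1:\ \ell_k\lambda\in\mathbb{Z}\}$; in particular $0$ is an eigenvalue with multiplicity $n-1$; 4. counted with multiplicity, the eigenvalues have uniform density $\sum_{k=1}^{n-1}\ell_k$: for every $a\in\mathbb{R}$, $$\frac{\text{number of eigenvalues of }P_B\text{ in }[a-R,a+R]\text{, counted with multiplicity}}{2R}\longrightarrow\sum_{k=1}^{n-1}\ell_k\qquad(R\to\infty).$$ -/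

import Mathlib

open MeasureTheory Filter Topology
open scoped ENNReal

noncomputable section

/-! ### Spectral notions for an unbounded operator on a complex Hilbert space -/

section Spectral

variable {H : Type*} [NormedAddCommGroup H] [InnerProductSpace ℂ H]

/-- The resolvent set of an operator `T` with domain in `H`: all `z` such that `T - z` is a
bijection from the domain of `T` onto `H` whose inverse `R` is bounded. -/
def resolventSetOf (T : H →ₗ.[ℂ] H) : Set ℂ :=
  {z | ∃ R : H →L[ℂ] H,
    (∀ x : H, ∃ h : R x ∈ T.domain, T ⟨R x, h⟩ - z • R x = x) ∧
    ∀ x : T.domain, R (T x - z • (x : H)) = x}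

/-- The spectrum of an operator: the complement of its resolvent set. -/
def spectrumOf (T : H →ₗ.[ℂ] H) : Set ℂ := (resolventSetOf T)ᶜ

/-- The eigenspace `{f ∈ dom T : T f = z f}`. -/
def eigenspaceOf (T : H →ₗ.[ℂ] H) (z : ℂ) : Submodule ℂ H :=
  T.graph.comap (LinearMap.id.prod (z • LinearMap.id))

theorem mem_eigenspaceOf_iff (T : H →ₗ.[ℂ] H) (z : ℂ) (f : H) :
    f ∈ eigenspaceOf T z ↔ ∃ h : f ∈ T.domain, T ⟨f, h⟩ = z • f := by
  simp [eigenspaceOf, LinearPMap.mem_graph_iff]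

/-- The discrete (point) spectrum: the set of all eigenvalues, embedded ones included. -/
def pointSpectrumOf (T : H →ₗ.[ℂ] H) : Set ℂ := {z | eigenspaceOf T z ≠ ⊥}

/-- The multiplicity of `z` as an eigenvalue: the dimension of the eigenspace
(`⊤` if it is infinite, `0` if `z` is not an eigenvalue). -/
def eigenMultiplicity (T : H →ₗ.[ℂ] H) (z : ℂ) : ℕ∞ :=
  Cardinal.toENat (Module.rank ℂ (eigenspaceOf T z))

/-- The number of eigenvalues in `[x, y]`, counted with multiplicity. -/
def eigenvalueCount (T : H →ₗ.[ℂ] H) (x y : ℝ) : ℝ≥0∞ :=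
  ∑' t : Set.Icc x y, (eigenMultiplicity T ((t : ℝ) : ℂ) : ℝ≥0∞)

/-- The part of `T` in a subspace `K`: the operator in `K` whose domain is
`{x ∈ K ∩ dom T : T x ∈ K}` and which acts there as `T`. -/
def partIn (T : H →ₗ.[ℂ] H) (K : Submodule ℂ H) : K →ₗ.[ℂ] K :=
  (T.graph.comap (K.subtype.prodMap K.subtype)).toLinearPMap

theorem mem_graph_partIn_iff (T : H →ₗ.[ℂ] H) (K : Submodule ℂ H) (x y : K) :
    (x, y) ∈ (partIn T K).graph ↔ ((x : H), (y : H)) ∈ T.graph := by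
  rw [partIn, Submodule.toLinearPMap_graph_eq]
  · rfl
  · rintro ⟨a, b⟩ hab ha
    have hab' : ((a : H), (b : H)) ∈ T.graph := hab
    have ha' : (a : H) = 0 := by simpa using ha
    have hb := T.graph_fst_eq_zero_snd hab' ha'
    simpa using hb

/-- The continuous subspace of a selfadjoint operator: the orthogonal complement of the span of
all its eigenvectors. -/
def continuousSubspace (T : H →ₗ.[ℂ] H) : Submodule ℂ H := (⨆ z : ℂ, eigenspaceOf T z)ᗮ

/-- The continuous spectrum of a selfadjoint operator: the spectrum of its part in the continuous
subspace. It may contain eigenvalues ("embedded" in the continuum). -/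
def continuousSpectrumOf (T : H →ₗ.[ℂ] H) : Set ℂ :=
  spectrumOf (partIn T (continuousSubspace T))

end Spectral

/-! ### The momentum operator on the complement of finitely many intervals

The number of removed intervals `[β i, α i]` is `n = m + 1`, so that there are `m = n - 1` bounded
components `(α k, β (k + 1))`, `k : Fin m`. -/

/-- The exterior domain `Ω = ℝ \ ⋃ i, [β i, α i]`. -/
def exteriorDomain {m : ℕ} (α β : Fin (m + 1) → ℝ) : Set ℝ :=
  (⋃ i, Set.Icc (β i) (α i))ᶜ

/-- The Hilbert space `L²(Ω)` of complex-valued functions. -/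
abbrev L2Ext {m : ℕ} (α β : Fin (m + 1) → ℝ) : Type :=
  Lp ℂ 2 (volume.restrict (exteriorDomain α β))

theorem isOpen_exteriorDomain {m : ℕ} (α β : Fin (m + 1) → ℝ) :
    IsOpen (exteriorDomain α β) :=
  (isClosed_iUnion_of_finite fun _ => isClosed_Icc).isOpen_compl

/-- The graph of `P_B = (1 / 2πi) d/dx` with boundary condition `B f(β) = f(α)`: a pair `(f, g)`
of elements of `L²(Ω)` such that `f` has a representative `F` which is absolutely continuous on
every compact interval in the closure of `Ω` (so that the values `F (β i)` and `F (α i)` are the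
one-sided boundary values from inside `Ω`), has derivative `2πi g` almost everywhere on `Ω`, and
satisfies the boundary condition. -/
def momentumGraph {m : ℕ} (α β : Fin (m + 1) → ℝ)
    (B : Matrix (Fin (m + 1)) (Fin (m + 1)) ℂ) : Submodule ℂ (L2Ext α β × L2Ext α β) where
  carrier := {p | ∃ F : ℝ → ℂ,
    F =ᵐ[volume.restrict (exteriorDomain α β)] p.1 ∧
    (∀ a b : ℝ, Set.uIcc a b ⊆ closure (exteriorDomain α β) →
      AbsolutelyContinuousOnInterval F a b) ∧
    (∀ᵐ x ∂(volume.restrict (exteriorDomain α β)),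
      HasDerivAt F (2 * Real.pi * Complex.I * p.2 x) x) ∧
    B.mulVec (fun i => F (β i)) = fun i => F (α i)}
  zero_mem' := by
    refine ⟨fun _ => 0, (Lp.coeFn_zero ℂ 2 _).symm, fun a b _ => ?_, ?_, ?_⟩
    · exact (contDiff_const (c := (0 : ℂ)) (n := 1)).contDiffOn.absolutelyContinuousOnInterval
    · filter_upwards [Lp.coeFn_zero ℂ 2 (volume.restrict (exteriorDomain α β))] with x hx
      have : (2 * Real.pi * Complex.I * (0 : L2Ext α β) x : ℂ) = 0 := by rw [hx]; simp
      rw [Prod.snd_zero, this]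
      exact hasDerivAt_const x 0
    · ext i; simp [Matrix.mulVec, dotProduct]
  add_mem' := by
    rintro ⟨f, g⟩ ⟨f', g'⟩ ⟨F, hF, hac, hd, hb⟩ ⟨F', hF', hac', hd', hb'⟩
    refine ⟨F + F', (hF.add hF').trans (Lp.coeFn_add f f').symm,
      fun a b h => (hac a b h).add (hac' a b h), ?_, ?_⟩
    · filter_upwards [hd, hd', Lp.coeFn_add g g'] with x h1 h2 h3
      have := h1.add h2
      simp only [Prod.snd_add] at *
      rw [h3, Pi.add_apply, mul_add]
      exact this
    · have : (fun i => (F + F') (β i)) = (fun i => F (β i)) + fun i => F' (β i) := rfl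
      rw [this, Matrix.mulVec_add, hb, hb']
      rfl
  smul_mem' := by
    rintro c ⟨f, g⟩ ⟨F, hF, hac, hd, hb⟩
    refine ⟨c • F, (hF.const_smul c).trans (Lp.coeFn_smul c f).symm,
      fun a b h => (hac a b h).const_smul c, ?_, ?_⟩
    · filter_upwards [hd, Lp.coeFn_smul c g] with x h1 h3
      have := h1.const_smul c
      simp only [Prod.smul_snd] at *
      rw [h3, Pi.smul_apply, mul_smul_comm]
      exact this
    · have : (fun i => (c • F) (β i)) = c • (fun i => F (β i)) := rfl
      rw [this, Matrix.mulVec_smul, hb]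
      rfl

theorem momentumGraph_single_valued {m : ℕ} (α β : Fin (m + 1) → ℝ)
    (B : Matrix (Fin (m + 1)) (Fin (m + 1)) ℂ) (p : L2Ext α β × L2Ext α β)
    (hp : p ∈ momentumGraph α β B) (h0 : p.1 = 0) : p.2 = 0 := by
  obtain ⟨F, hF, hac, hd, -⟩ := hp
  have hopen := isOpen_exteriorDomain α β
  have hF0 : ∀ᵐ x ∂(volume.restrict (exteriorDomain α β)), F x = 0 := by
    rw [h0] at hF
    exact hF.trans (Lp.coeFn_zero ℂ 2 _)
  have hcont : ContinuousOn F (exteriorDomain α β) := by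
    intro x hx
    obtain ⟨ε, hε, hball⟩ := Metric.isOpen_iff.1 hopen x hx
    have hle : x - ε / 2 ≤ x + ε / 2 := by linarith
    have hsub : Set.Icc (x - ε / 2) (x + ε / 2) ⊆ exteriorDomain α β := by
      rw [← Real.closedBall_eq_Icc]
      exact (Metric.closedBall_subset_ball (by linarith)).trans hball
    have h1 := (hac (x - ε / 2) (x + ε / 2)
      (by rw [Set.uIcc_of_le hle]; exact hsub.trans subset_closure)).continuousOn
    rw [Set.uIcc_of_le hle] at h1
    exact (h1.continuousAt (Icc_mem_nhds (by linarith) (by linarith))).continuousWithinAt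
  have hzero : Set.EqOn F (fun _ => 0) (exteriorDomain α β) :=
    Measure.eqOn_open_of_ae_eq hF0 hopen hcont continuousOn_const
  refine (Lp.eq_zero_iff_ae_eq_zero).2 ?_
  filter_upwards [hd, ae_restrict_mem hopen.measurableSet] with x hx hxm
  have h2 : HasDerivAt F 0 x :=
    (hasDerivAt_const x (0 : ℂ)).congr_of_eventuallyEq
      (eventually_of_mem (hopen.mem_nhds hxm) hzero)
  have h3 := hx.unique h2
  have hpi : (Real.pi : ℂ) ≠ 0 := by exact_mod_cast Real.pi_ne_zero
  simpa [hpi, Complex.I_ne_zero] using h3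

/-- The operator `P_B` in `L²(Ω)`. -/
def momentumOperator {m : ℕ} (α β : Fin (m + 1) → ℝ)
    (B : Matrix (Fin (m + 1)) (Fin (m + 1)) ℂ) : L2Ext α β →ₗ.[ℂ] L2Ext α β :=
  (momentumGraph α β B).toLinearPMap

theorem momentumOperator_graph {m : ℕ} (α β : Fin (m + 1) → ℝ)
    (B : Matrix (Fin (m + 1)) (Fin (m + 1)) ℂ) :
    (momentumOperator α β B).graph = momentumGraph α β B :=
  Submodule.toLinearPMap_graph_eq _ fun p hp h0 => momentumGraph_single_valued α β B p hp h0

/-- The `n × n` block matrix `[[0, I_{n-1}], [c, 0]]` with `n = m + 1`: the entries just above the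
diagonal are `1`, the bottom left entry is `c`, and all others are `0`. -/
def decouplingMatrix (m : ℕ) (c : ℂ) : Matrix (Fin (m + 1)) (Fin (m + 1)) ℂ :=
  Matrix.of fun i j =>
    if (j : ℕ) = i + 1 then 1 else if i = Fin.last m ∧ j = 0 then c else 0

/-- The length of the bounded component `(α k, β (k + 1))` of `Ω`. -/
def gapLength {m : ℕ} (α β : Fin (m + 1) → ℝ) (k : Fin m) : ℝ := β k.succ - α k.castSucc

end

/-! The boundary condition splits into `F (β k.succ) = F (α k.castSucc)` for each `k : Fin m`, and
`c * F (β 0) = F (α (Fin.last m))`. Hence `P_B` is an orthogonal sum: on each bounded component the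
momentum operator with periodic boundary values, that is, on a circle of length `ℓ_k`, and on the
two half-lines, joined by the phase `c`, a copy of the momentum operator on the whole line. The
circles supply all eigenvalues and the line supplies the continuous spectrum.

Eigenvalues: a solution of `P f = z f` is a multiple of `planeWave z` on each component
(`planeWave_neg_mul_sub_eq`). On the two half-lines, for every complex `z`, it fails to decay on at
least one of them and so must vanish; on a bounded component periodicity forces `ℓ_k z` to be an
integer (`exists_eigenfunction`). Thus the cut-off plane waves `gapMode` with `ℓ_k z` integral form
a basis of the eigenspace (`eigenspaceOf_momentumOperator`), and counting eigenvalues amounts to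
counting integers in the intervals `[ℓ_k (a - R), ℓ_k (a + R)]`.

Continuous spectrum: by completeness of the Fourier basis on each bounded component, the continuous
subspace consists of the functions that vanish on all of them (`mem_continuousSubspace_iff`). A real
`t` is in the spectrum because a resonant source with unbounded primitive has no square integrable
solution (`ofReal_notMem_resolventSetOf`). A non-real `z` is in the resolvent set because variation
of constants solves the equation on the line, with an `L²` bound from Young's inequality for an
exponentially decaying kernel (`exists_solution_continuousSubspace`). -/

noncomputable section

/-! ### Plane waves -/

/-- The plane wave `x ↦ exp (2πi z x)`. -/
def planeWave (z : ℂ) (x : ℝ) : ℂ := Complex.exp (2 * Real.pi * Complex.I * z * x)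

theorem planeWave_ne_zero (z : ℂ) (x : ℝ) : planeWave z x ≠ 0 := Complex.exp_ne_zero _

theorem planeWave_add (z : ℂ) (x y : ℝ) :
    planeWave z (x + y) = planeWave z x * planeWave z y := by
  rw [planeWave, planeWave, planeWave, ← Complex.exp_add]
  push_cast
  ring_nf

theorem planeWave_neg_mul (z : ℂ) (x : ℝ) : planeWave (-z) x * planeWave z x = 1 := by
  rw [planeWave, planeWave, ← Complex.exp_add]
  simp

theorem norm_planeWave (z : ℂ) (x : ℝ) :
    ‖planeWave z x‖ = Real.exp (-(2 * Real.pi * z.im * x)) := by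
  rw [planeWave, Complex.norm_exp]
  congr 1
  simp

theorem hasDerivAt_planeWave (z : ℂ) (x : ℝ) :
    HasDerivAt (planeWave z) (2 * Real.pi * Complex.I * z * planeWave z x) x := by
  have h1 : HasDerivAt (fun y : ℝ => 2 * Real.pi * Complex.I * z * (y : ℂ))
      (2 * Real.pi * Complex.I * z) x := by
    simpa using (Complex.ofRealCLM.hasDerivAt (x := x)).const_mul (2 * Real.pi * Complex.I * z)
  have h2 := h1.cexp
  rw [mul_comm (Complex.exp _)] at h2
  exact h2

theorem contDiff_planeWave (z : ℂ) {n : WithTop ℕ∞} : ContDiff ℝ n (planeWave z) := by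
  unfold planeWave
  exact (contDiff_const.mul Complex.ofRealCLM.contDiff).cexp

theorem continuous_planeWave (z : ℂ) : Continuous (planeWave z) :=
  (contDiff_planeWave z (n := 0)).continuous

theorem planeWave_eq_one_iff (z : ℂ) (x : ℝ) :
    planeWave z x = 1 ↔ ∃ j : ℤ, (x : ℂ) * z = j := by
  have hpi : (Real.pi : ℂ) ≠ 0 := by exact_mod_cast Real.pi_ne_zero
  have hne : (2 * Real.pi * Complex.I : ℂ) ≠ 0 := by simp [hpi]
  rw [planeWave, Complex.exp_eq_one_iff]
  refine exists_congr fun j => ?_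
  rw [mul_assoc, mul_comm (j : ℂ), mul_right_inj' hne, mul_comm z]

/-! ### Absolutely continuous functions -/

namespace AbsolutelyContinuousOnInterval

theorem congr {X : Type*} [PseudoMetricSpace X] {f g : ℝ → X} {a b : ℝ}
    (hf : AbsolutelyContinuousOnInterval f a b) (h : Set.EqOn f g (Set.uIcc a b)) :
    AbsolutelyContinuousOnInterval g a b := by
  rw [absolutelyContinuousOnInterval_iff] at hf ⊢
  intro ε hε
  obtain ⟨δ, hδ, H⟩ := hf ε hε
  refine ⟨δ, hδ, fun E hE hlt => ?_⟩
  have := H E hE hlt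
  rwa [Finset.sum_congr rfl fun i hi => by
    rw [← h (hE.1 i hi).1, ← h (hE.1 i hi).2]]

/-- With `w = 1` and `w = I` this reassembles a complex function from its real and imaginary parts.
-/
theorem ofReal_comp {f : ℝ → ℝ} {a b : ℝ} (hf : AbsolutelyContinuousOnInterval f a b) (w : ℂ) :
    AbsolutelyContinuousOnInterval (fun x => f x • w) a b :=
  hf.smul (g := fun _ => w)
    (contDiff_const (c := w) (n := 1)).contDiffOn.absolutelyContinuousOnInterval

end AbsolutelyContinuousOnInterval

theorem ContDiff.absolutelyContinuousOnInterval {f : ℝ → ℂ} (hf : ContDiff ℝ 1 f) (a b : ℝ) :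
    AbsolutelyContinuousOnInterval f a b :=
  hf.contDiffOn.absolutelyContinuousOnInterval

/-- A primitive of a locally integrable complex function is absolutely continuous. -/
theorem absolutelyContinuousOnInterval_of_primitive {H G : ℝ → ℂ} (hG : LocallyIntegrable G)
    (hH : ∀ a b, H b - H a = ∫ t in a..b, G t) (a b : ℝ) :
    AbsolutelyContinuousOnInterval H a b := by
  have hint : IntervalIntegrable G volume a b :=
    (hG.integrableOn_isCompact isCompact_uIcc).intervalIntegrable
  have hre : IntervalIntegrable (fun t => (G t).re) volume a b :=
    ⟨hint.1.re, hint.2.re⟩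
  have him : IntervalIntegrable (fun t => (G t).im) volume a b :=
    ⟨hint.1.im, hint.2.im⟩
  have h1 := (hre.absolutelyContinuousOnInterval_intervalIntegral
    (c := a) Set.left_mem_uIcc).ofReal_comp 1
  have h2 := (him.absolutelyContinuousOnInterval_intervalIntegral
    (c := a) Set.left_mem_uIcc).ofReal_comp Complex.I
  have h3 := (contDiff_const (c := H a) (n := 1)).absolutelyContinuousOnInterval a b
  refine ((h1.add h2).add h3).congr fun x hx => ?_
  have hx' : IntervalIntegrable G volume a x :=
    (hG.integrableOn_isCompact isCompact_uIcc).intervalIntegrable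
  have e := hH a x
  have er : (∫ t in a..x, (G t).re) = (∫ t in a..x, G t).re :=
    intervalIntegral.intervalIntegral_re hx'
  have ei : (∫ t in a..x, (G t).im) = (∫ t in a..x, G t).im :=
    intervalIntegral.intervalIntegral_im hx'
  simp only [Pi.add_apply, er, ei, ← e]
  simp only [Complex.real_smul, mul_one, Complex.re_add_im]
  ring

/-- A primitive of a locally integrable function is differentiable almost everywhere. -/
theorem ae_hasDerivAt_of_primitive {H G : ℝ → ℂ} (hG : LocallyIntegrable G)
    (hH : ∀ a b, H b - H a = ∫ t in a..b, G t) : ∀ᵐ x, HasDerivAt H (G x) x := by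
  filter_upwards [LocallyIntegrable.ae_hasDerivAt_integral hG] with x hx
  refine ((hx 0).add_const (H 0)).congr_of_eventuallyEq (Eventually.of_forall fun y => ?_)
  simp only [← hH 0 y]
  ring

/-- Conservation law for `F' = 2πi (z F + g)` on an interval: `planeWave (-z) * F` differs from a
primitive of `2πi g * planeWave (-z)` by a constant. -/
theorem planeWave_neg_mul_sub_eq {F g U : ℝ → ℂ} {z : ℂ} {a b : ℝ} (hab : a ≤ b)
    (hF : AbsolutelyContinuousOnInterval F a b)
    (hd : ∀ᵐ x, x ∈ Set.Ioo a b →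
      HasDerivAt F (2 * Real.pi * Complex.I * (g x + z * F x)) x)
    (hU : ContDiff ℝ 1 U)
    (hUd : ∀ᵐ x, x ∈ Set.Ioo a b →
      HasDerivAt U (2 * Real.pi * Complex.I * (planeWave (-z) x * g x)) x) :
    planeWave (-z) b * F b - U b = planeWave (-z) a * F a - U a := by
  have hac : AbsolutelyContinuousOnInterval (planeWave (-z) • F - U) a b :=
    (((contDiff_planeWave (-z)).absolutelyContinuousOnInterval a b).smul hF).sub
      (hU.absolutelyContinuousOnInterval a b)
  have hne : ∀ y : ℝ, ∀ᵐ x : ℝ, x ≠ y := fun y => by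
    simp [ae_iff, measure_singleton]
  -- The derivatives are only known in the open interval; the two endpoints form a null set.
  -- Absolute continuity then turns an almost everywhere zero derivative into constancy.
  have h0 : ∀ᵐ x, x ∈ Set.uIcc a b → HasDerivAt (planeWave (-z) • F - U) 0 x := by
    filter_upwards [hd, hUd, hne a, hne b] with x hx hux ha hb hmem
    rw [Set.uIcc_of_le hab] at hmem
    have hx' : x ∈ Set.Ioo a b := ⟨lt_of_le_of_ne hmem.1 (Ne.symm ha), lt_of_le_of_ne hmem.2 hb⟩
    have h := ((hasDerivAt_planeWave (-z) x).mul (hx hx')).sub (hux hx')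
    have e : 2 * Real.pi * Complex.I * -z * planeWave (-z) x * F x +
        planeWave (-z) x * (2 * Real.pi * Complex.I * (g x + z * F x)) -
        2 * Real.pi * Complex.I * (planeWave (-z) x * g x) = 0 := by ring
    rw [e] at h
    exact h
  obtain ⟨C, hC⟩ := hac.const_of_ae_hasDerivAt_zero h0
  have h1 := hC a Set.left_mem_uIcc
  have h2 := hC b Set.right_mem_uIcc
  simp only [Pi.sub_apply, smul_eq_mul, Pi.mul_apply] at h1 h2
  rw [h1, h2]

/-- A function bounded below in norm on an unbounded half-line is not square integrable there. -/
theorem not_memLp_of_le_norm {s t : Set ℝ} {F : ℝ → ℂ} {ε : ℝ} (hε : 0 < ε) (ht : MeasurableSet t)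
    (hts : t ⊆ s) (hinf : volume t = ∞) (hle : ∀ x ∈ t, ε ≤ ‖F x‖) :
    ¬ MemLp F 2 (volume.restrict s) := by
  intro hF
  have h1 : MemLp F 2 (volume.restrict t) := hF.mono_measure (Measure.restrict_mono hts le_rfl)
  have h2 : MemLp (fun _ : ℝ => ε) 2 (volume.restrict t) := by
    refine h1.mono aestronglyMeasurable_const ?_
    filter_upwards [ae_restrict_mem ht] with x hx
    rw [Real.norm_of_nonneg hε.le]
    exact hle x hx
  rw [memLp_const_iff (by norm_num) (by norm_num)] at h2
  rcases h2 with h2 | h2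
  · exact hε.ne' h2
  · simp [hinf] at h2

/-! ### Operators in a Hilbert space -/

section Spectral

variable {H : Type*} [NormedAddCommGroup H] [InnerProductSpace ℂ H]

/-- If `T - z` is injective, and onto with a bound on the solutions, then `z` is in the resolvent
set. -/
theorem mem_resolventSetOf_of_bound {T : H →ₗ.[ℂ] H} {z : ℂ} (C : ℝ)
    (hinj : ∀ x, (x, z • x) ∈ T.graph → x = 0)
    (hsurj : ∀ y, ∃ x, (x, y + z • x) ∈ T.graph ∧ ‖x‖ ≤ C * ‖y‖) : z ∈ resolventSetOf T := by
  -- Uniqueness of solutions makes the chosen solution map linear and a left inverse of `T - z`.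
  have huniq : ∀ {x x' y : H}, (x, y + z • x) ∈ T.graph → (x', y + z • x') ∈ T.graph →
      x = x' := by
    intro x x' y h h'
    have := T.graph.sub_mem h h'
    refine sub_eq_zero.1 (hinj _ ?_)
    convert this using 1
    simp [smul_sub]
  choose r hr hb using hsurj
  let R₀ : H →ₗ[ℂ] H :=
    { toFun := r
      map_add' := fun y y' => by
        refine huniq (hr _) ?_
        have := T.graph.add_mem (hr y) (hr y')
        convert this using 1
        simp only [smul_add, Prod.mk_add_mk, Prod.mk.injEq, true_and]
        abel
      map_smul' := fun a y => by
        refine huniq (hr _) ?_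
        have := T.graph.smul_mem a (hr y)
        convert this using 1
        rw [Prod.smul_mk, smul_add, smul_comm a z]
        rfl }
  refine ⟨R₀.mkContinuous C hb, fun x => ?_, fun x => ?_⟩
  · have hx : r x ∈ T.domain := T.mem_domain_of_mem_graph (hr x)
    refine ⟨hx, ?_⟩
    have : T ⟨r x, hx⟩ = x + z • r x :=
      T.mem_graph_snd_inj' (T.mem_graph ⟨r x, hx⟩) (hr x) rfl
    change T ⟨r x, hx⟩ - z • r x = x
    rw [this]
    abel
  · refine huniq (y := T x - z • (x : H)) (hr _) ?_
    have := T.mem_graph x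
    convert this using 2
    abel

/-- Surjectivity alone is enough to exclude real points: a single source without a solution
suffices. -/
theorem exists_mem_graph_of_mem_resolventSetOf {T : H →ₗ.[ℂ] H} {z : ℂ}
    (hz : z ∈ resolventSetOf T) (y : H) : ∃ x, (x, y + z • x) ∈ T.graph := by
  obtain ⟨R, h1, -⟩ := hz
  obtain ⟨h, e⟩ := h1 y
  refine ⟨R y, ?_⟩
  have := T.mem_graph ⟨R y, h⟩
  rwa [sub_eq_iff_eq_add.1 e] at this

end Spectral

/-! ### Geometry of the exterior domain -/

/-- If neither end alternative holds, then `Q 0` holds, and without a switch from `Q` to `P` it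
propagates to the last index. Applied to `x < β i` or `α i < x`, this locates a point or an interval
in a component. -/
theorem Fin.exists_transition {m : ℕ} {P Q : Fin (m + 1) → Prop} (h : ∀ i, P i ∨ Q i) :
    P 0 ∨ Q (Fin.last m) ∨ ∃ k : Fin m, Q k.castSucc ∧ P k.succ := by
  by_contra! hc
  obtain ⟨h0, hl, hk⟩ := hc
  have hQ : ∀ i, Q i := by
    intro i
    induction i using Fin.induction with
    | zero => exact (h 0).resolve_left h0
    | succ k ih => exact (h k.succ).resolve_left (hk k ih)
  exact hl (hQ _)

/-- The endpoints are ordered as `β 0 < α 0 < β 1 < α 1 < ⋯`. -/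
structure Interlaced {m : ℕ} (α β : Fin (m + 1) → ℝ) : Prop where
  β_lt_α : ∀ i, β i < α i
  α_lt_β_succ : ∀ k : Fin m, α k.castSucc < β k.succ

namespace Interlaced

variable {m : ℕ} {α β : Fin (m + 1) → ℝ}

theorem β_monotone (h : Interlaced α β) : Monotone β :=
  (Fin.strictMono_iff_lt_succ.2 fun k =>
    (h.β_lt_α k.castSucc).trans (h.α_lt_β_succ k)).monotone

theorem α_monotone (h : Interlaced α β) : Monotone α :=
  (Fin.strictMono_iff_lt_succ.2 fun k =>
    (h.α_lt_β_succ k).trans (h.β_lt_α k.succ)).monotone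

theorem β_zero_lt_α_last (h : Interlaced α β) : β 0 < α (Fin.last m) :=
  (h.β_monotone (Fin.zero_le (Fin.last m))).trans_lt (h.β_lt_α _)

theorem β_zero_lt_α (h : Interlaced α β) (i : Fin (m + 1)) : β 0 < α i :=
  (h.β_monotone (Fin.zero_le i)).trans_lt (h.β_lt_α _)

theorem β_lt_α_last (h : Interlaced α β) (i : Fin (m + 1)) : β i < α (Fin.last m) :=
  (h.β_lt_α i).trans_le (h.α_monotone (Fin.le_last i))

theorem Iio_subset (h : Interlaced α β) : Set.Iio (β 0) ⊆ exteriorDomain α β := by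
  intro x hx hmem
  obtain ⟨i, hi⟩ := Set.mem_iUnion.1 hmem
  exact absurd hx (not_lt.2 ((h.β_monotone (Fin.zero_le i)).trans hi.1))

theorem Ioi_subset (h : Interlaced α β) : Set.Ioi (α (Fin.last m)) ⊆ exteriorDomain α β := by
  intro x hx hmem
  obtain ⟨i, hi⟩ := Set.mem_iUnion.1 hmem
  exact absurd hx (not_lt.2 (hi.2.trans (h.α_monotone (Fin.le_last i))))

theorem gap_subset (h : Interlaced α β) (k : Fin m) :
    Set.Ioo (α k.castSucc) (β k.succ) ⊆ exteriorDomain α β := by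
  intro x hx hmem
  obtain ⟨i, hi⟩ := Set.mem_iUnion.1 hmem
  rcases le_or_gt i k.castSucc with hik | hik
  · exact absurd hx.1 (not_lt.2 (hi.2.trans (h.α_monotone hik)))
  · exact absurd hx.2 (not_lt.2 ((h.β_monotone (Fin.castSucc_lt_iff_succ_le.1 hik)).trans hi.1))

theorem mem_gap_of_mem_Icc (h : Interlaced α β) {k : Fin m} {x : ℝ}
    (hx : x ∈ Set.Icc (α k.castSucc) (β k.succ)) (hmem : x ∈ exteriorDomain α β) :
    x ∈ Set.Ioo (α k.castSucc) (β k.succ) := by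
  have hx1 : x ≠ α k.castSucc := by
    rintro rfl
    exact hmem (Set.mem_iUnion.2 ⟨_, (h.β_lt_α _).le, le_rfl⟩)
  have hx2 : x ≠ β k.succ := by
    rintro rfl
    exact hmem (Set.mem_iUnion.2 ⟨_, le_rfl, (h.β_lt_α _).le⟩)
  exact ⟨lt_of_le_of_ne hx.1 hx1.symm, lt_of_le_of_ne hx.2 hx2⟩

theorem disjoint_gaps (h : Interlaced α β) {k l : Fin m} (hkl : k ≠ l) :
    Disjoint (Set.Icc (α k.castSucc) (β k.succ)) (Set.Icc (α l.castSucc) (β l.succ)) := by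
  rw [Set.disjoint_left]
  intro x hk hl
  rcases lt_or_gt_of_ne hkl with hlt | hlt
  · have : β k.succ < α l.castSucc :=
      (h.β_monotone (show k.succ ≤ l.castSucc from Fin.succ_le_castSucc_iff.2 hlt)).trans_lt
        (h.β_lt_α _)
    linarith [hk.2, hl.1]
  · have : β l.succ < α k.castSucc :=
      (h.β_monotone (show l.succ ≤ k.castSucc from Fin.succ_le_castSucc_iff.2 hlt)).trans_lt
        (h.β_lt_α _)
    linarith [hl.2, hk.1]

theorem _root_.mem_pieces_of_mem_exteriorDomain {x : ℝ} (hx : x ∈ exteriorDomain α β) :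
    x < β 0 ∨ α (Fin.last m) < x ∨ ∃ k : Fin m, x ∈ Set.Ioo (α k.castSucc) (β k.succ) := by
  refine Fin.exists_transition (P := fun i => x < β i) (Q := fun i => α i < x) fun i => ?_
  by_contra! hc
  exact hx (Set.mem_iUnion.2 ⟨i, hc.1, hc.2⟩)

theorem _root_.Icc_subset_closure_exteriorDomain {a b : ℝ} (hab : a < b)
    (hs : Set.Ioo a b ⊆ exteriorDomain α β) : Set.uIcc a b ⊆ closure (exteriorDomain α β) := by
  rw [Set.uIcc_of_le hab.le, ← closure_Ioo hab.ne]
  exact closure_mono hs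

/-- The open intervals `(β i, α i)` miss the closure of the domain, so a compact interval inside
that closure lies on one side of each of them. -/
theorem pieces_of_Icc_subset_closure (h : Interlaced α β) {a b : ℝ} (hab : a ≤ b)
    (hs : Set.Icc a b ⊆ closure (exteriorDomain α β)) :
    b ≤ β 0 ∨ α (Fin.last m) ≤ a ∨ ∃ k : Fin m, α k.castSucc ≤ a ∧ b ≤ β k.succ := by
  refine Fin.exists_transition (P := fun i => b ≤ β i) (Q := fun i => α i ≤ a) fun i => ?_
  by_contra! hc
  have hdisj : Disjoint (Set.Ioo (β i) (α i)) (closure (exteriorDomain α β)) := by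
    refine Disjoint.closure_right ?_ isOpen_Ioo
    rw [Set.disjoint_left]
    intro x hx hmem
    exact hmem (Set.mem_iUnion.2 ⟨i, Set.Ioo_subset_Icc_self hx⟩)
  have hlt : β i < min b (α i) := lt_min hc.1 (h.β_lt_α i)
  -- If the interval met `(β i, α i)`, then `max a x` would be a common point.
  obtain ⟨x, hx1, hx2⟩ := exists_between hlt
  have hxa : max a x ∈ Set.Ioo (β i) (α i) :=
    ⟨lt_max_of_lt_right hx1, max_lt hc.2 (hx2.trans_le (min_le_right _ _))⟩
  have hxb : max a x ∈ Set.Icc a b :=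
    ⟨le_max_left _ _, max_le hab (hx2.le.trans (min_le_left _ _))⟩
  exact Set.disjoint_left.1 hdisj hxa (hs hxb)

/-- A function that agrees with an absolutely continuous function on each closed component is
absolutely continuous on all compact intervals in the closure of the exterior domain. -/
theorem absolutelyContinuousOnInterval_of_pieces (h : Interlaced α β)
    {F A B : ℝ → ℂ} {M : Fin m → ℝ → ℂ}
    (hA : ∀ a b, AbsolutelyContinuousOnInterval A a b)
    (hB : ∀ a b, AbsolutelyContinuousOnInterval B a b)
    (hM : ∀ k a b, AbsolutelyContinuousOnInterval (M k) a b)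
    (hFA : Set.EqOn A F (Set.Iic (β 0))) (hFB : Set.EqOn B F (Set.Ici (α (Fin.last m))))
    (hFM : ∀ k, Set.EqOn (M k) F (Set.Icc (α k.castSucc) (β k.succ))) (a b : ℝ)
    (hs : Set.uIcc a b ⊆ closure (exteriorDomain α β)) :
    AbsolutelyContinuousOnInterval F a b := by
  wlog hab : a ≤ b generalizing a b
  · exact (this b a (Set.uIcc_comm a b ▸ hs) (le_of_not_ge hab)).symm
  rw [Set.uIcc_of_le hab] at hs
  rcases h.pieces_of_Icc_subset_closure hab hs with hb | ha | ⟨k, ha, hb⟩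
  · refine (hA a b).congr (hFA.mono ?_)
    rw [Set.uIcc_of_le hab]
    exact fun x hx => hx.2.trans hb
  · refine (hB a b).congr (hFB.mono ?_)
    rw [Set.uIcc_of_le hab]
    exact fun x hx => ha.trans hx.1
  · refine (hM k a b).congr ((hFM k).mono ?_)
    rw [Set.uIcc_of_le hab]
    exact Set.Icc_subset_Icc ha hb

end Interlaced

/-! ### The graph of the momentum operator -/

theorem decouplingMatrix_mulVec_castSucc {m : ℕ} (c : ℂ) (v : Fin (m + 1) → ℂ) (k : Fin m) :
    (decouplingMatrix m c).mulVec v k.castSucc = v k.succ := by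
  rw [Matrix.mulVec, dotProduct, Finset.sum_eq_single k.succ]
  · simp [decouplingMatrix]
  · intro j _ hj
    have h1 : (j : ℕ) ≠ k + 1 := fun e => hj (Fin.ext (by simpa using e))
    have h2 : k.castSucc ≠ Fin.last m := (Fin.castSucc_lt_last k).ne
    simp [decouplingMatrix, h1, h2]
  · simp

theorem decouplingMatrix_mulVec_last {m : ℕ} (c : ℂ) (v : Fin (m + 1) → ℂ) :
    (decouplingMatrix m c).mulVec v (Fin.last m) = c * v 0 := by
  rw [Matrix.mulVec, dotProduct, Finset.sum_eq_single 0]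
  · simp [decouplingMatrix]
  · intro j _ hj
    have h1 : (j : ℕ) ≠ m + 1 := j.2.ne
    simp [decouplingMatrix, h1, hj]
  · simp

/-- This is the decoupling: periodicity on every bounded component, and one relation between the two
half-lines. -/
theorem decouplingMatrix_mulVec_eq_iff {m : ℕ} (c : ℂ) (v w : Fin (m + 1) → ℂ) :
    (decouplingMatrix m c).mulVec v = w ↔
      (∀ k : Fin m, v k.succ = w k.castSucc) ∧ c * v 0 = w (Fin.last m) := by
  constructor
  · rintro rfl
    exact ⟨fun k => (decouplingMatrix_mulVec_castSucc c v k).symm,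
      (decouplingMatrix_mulVec_last c v).symm⟩
  · rintro ⟨h1, h2⟩
    ext i
    induction i using Fin.lastCases with
    | last => rw [decouplingMatrix_mulVec_last, h2]
    | cast k => rw [decouplingMatrix_mulVec_castSucc, h1]

/-- The graph condition for `(P - z) f = g`, with the derivative expressed through the absolutely
continuous representative of `f`. -/
theorem mem_graph_momentumOperator_iff {m : ℕ} {α β : Fin (m + 1) → ℝ} {c z : ℂ}
    {f g : L2Ext α β} :
    (f, g + z • f) ∈ (momentumOperator α β (decouplingMatrix m c)).graph ↔
      ∃ F : ℝ → ℂ, F =ᵐ[volume.restrict (exteriorDomain α β)] f ∧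
        (∀ a b : ℝ, Set.uIcc a b ⊆ closure (exteriorDomain α β) →
          AbsolutelyContinuousOnInterval F a b) ∧
        (∀ᵐ x ∂(volume.restrict (exteriorDomain α β)),
          HasDerivAt F (2 * Real.pi * Complex.I * (g x + z * F x)) x) ∧
        (∀ k : Fin m, F (β k.succ) = F (α k.castSucc)) ∧
        c * F (β 0) = F (α (Fin.last m)) := by
  rw [momentumOperator_graph]
  refine exists_congr fun F => and_congr_right fun hF => and_congr_right fun _ => ?_
  rw [decouplingMatrix_mulVec_eq_iff]
  refine and_congr_left fun _ => ?_
  have hval : ∀ᵐ x ∂(volume.restrict (exteriorDomain α β)), (g + z • f) x = g x + z * F x := by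
    filter_upwards [hF, Lp.coeFn_add g (z • f), Lp.coeFn_smul z f] with x h1 h2 h3
    rw [h2, Pi.add_apply, h3, Pi.smul_apply, smul_eq_mul, h1]
  refine eventually_congr ?_
  filter_upwards [hval] with x hx
  rw [hx]

/-- The evolution of a solution of `(P - z) f = g` inside the exterior domain. -/
theorem planeWave_neg_mul_sub_eq_of_solution {m : ℕ} {α β : Fin (m + 1) → ℝ} {F g U : ℝ → ℂ}
    {z : ℂ} {a b : ℝ}
    (hab : a < b) (hs : Set.Ioo a b ⊆ exteriorDomain α β)
    (hac : ∀ a b : ℝ, Set.uIcc a b ⊆ closure (exteriorDomain α β) →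
      AbsolutelyContinuousOnInterval F a b)
    (hd : ∀ᵐ x ∂(volume.restrict (exteriorDomain α β)),
      HasDerivAt F (2 * Real.pi * Complex.I * (g x + z * F x)) x)
    (hU : ContDiff ℝ 1 U)
    (hUd : ∀ᵐ x ∂(volume.restrict (exteriorDomain α β)), x ∈ Set.Ioo a b →
      HasDerivAt U (2 * Real.pi * Complex.I * (planeWave (-z) x * g x)) x) :
    planeWave (-z) b * F b - U b = planeWave (-z) a * F a - U a := by
  have hm := (isOpen_exteriorDomain α β).measurableSet
  rw [ae_restrict_iff' hm] at hd hUd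
  refine planeWave_neg_mul_sub_eq (g := g) hab.le
    (hac a b (Icc_subset_closure_exteriorDomain hab hs))
    ?_ hU ?_
  · filter_upwards [hd] with x hx hmem using hx (hs hmem)
  · filter_upwards [hUd] with x hx hmem using hx (hs hmem) hmem

/-! ### Eigenfunctions -/

theorem mem_eigenspaceOf_iff_mem_graph {H : Type*} [NormedAddCommGroup H] [InnerProductSpace ℂ H]
    (T : H →ₗ.[ℂ] H) (z : ℂ) (f : H) : f ∈ eigenspaceOf T z ↔ (f, 0 + z • f) ∈ T.graph := by
  rw [zero_add]
  rfl

/-- With zero source the conserved quantity on each component is `planeWave (-z) * F`. -/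
theorem exists_representative_of_mem_eigenspaceOf {m : ℕ} {α β : Fin (m + 1) → ℝ} {c z : ℂ}
    {f : L2Ext α β}
    (hf : f ∈ eigenspaceOf (momentumOperator α β (decouplingMatrix m c)) z) :
    ∃ F : ℝ → ℂ, F =ᵐ[volume.restrict (exteriorDomain α β)] f ∧
      (∀ a b : ℝ, a < b → Set.Ioo a b ⊆ exteriorDomain α β →
        planeWave (-z) b * F b = planeWave (-z) a * F a) ∧
      (∀ k : Fin m, F (β k.succ) = F (α k.castSucc)) ∧ c * F (β 0) = F (α (Fin.last m)) := by
  rw [mem_eigenspaceOf_iff_mem_graph, mem_graph_momentumOperator_iff] at hf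
  obtain ⟨F, hF, hac, hd, hb⟩ := hf
  refine ⟨F, hF, fun a b hab hs => ?_, hb⟩
  have := planeWave_neg_mul_sub_eq_of_solution (U := fun _ => 0) hab hs hac hd contDiff_const ?_
  · simpa using this
  · filter_upwards [Lp.coeFn_zero ℂ 2 (volume.restrict (exteriorDomain α β))] with x hx _
    rw [hx]
    simpa using hasDerivAt_const x (0 : ℂ)

/-- Passing from `a` to `b` multiplies the modulus of a homogeneous solution by `exp (-2π z.im (b -
a))`. With `b` the finite endpoint of a half-line and `a` a variable point in it, this bounds the
solution below on the half-line. -/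
theorem norm_le_of_planeWave_neg_mul_eq {z u v : ℂ} {a b : ℝ}
    (h : planeWave (-z) b * v = planeWave (-z) a * u) (hle : 0 ≤ z.im * (b - a)) : ‖v‖ ≤ ‖u‖ := by
  have h1 := congrArg norm h
  rw [norm_mul, norm_mul, norm_planeWave, norm_planeWave] at h1
  have h2 : Real.exp (-(2 * Real.pi * (-z).im * a)) ≤ Real.exp (-(2 * Real.pi * (-z).im * b)) := by
    rw [Real.exp_le_exp, Complex.neg_im]
    nlinarith [Real.pi_pos, mul_nonneg Real.pi_pos.le hle]
  have h3 : Real.exp (-(2 * Real.pi * (-z).im * b)) * ‖v‖ ≤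
      Real.exp (-(2 * Real.pi * (-z).im * b)) * ‖u‖ :=
    h1.le.trans (mul_le_mul_of_nonneg_right h2 (norm_nonneg _))
  exact le_of_mul_le_mul_left h3 (Real.exp_pos _)

/-- Eigenfunctions vanish on the unbounded components, and on a bounded component they are a
multiple of a plane wave, which is `0` unless the plane wave is periodic there. -/
theorem exists_eigenfunction {m : ℕ} {α β : Fin (m + 1) → ℝ} (h : Interlaced α β) {c z : ℂ}
    (hc : ‖c‖ = 1) {f : L2Ext α β}
    (hf : f ∈ eigenspaceOf (momentumOperator α β (decouplingMatrix m c)) z) :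
    ∃ F : ℝ → ℂ, F =ᵐ[volume.restrict (exteriorDomain α β)] f ∧
      (∀ x, x < β 0 → F x = 0) ∧ (∀ x, α (Fin.last m) < x → F x = 0) ∧
      ∃ w : Fin m → ℂ, ∀ k,
        (∀ x ∈ Set.Ioo (α k.castSucc) (β k.succ), F x = w k * planeWave z x) ∧
        (w k ≠ 0 → ∃ j : ℤ, (gapLength α β k : ℂ) * z = j) := by
  obtain ⟨F, hF, hev, hper, hcoup⟩ := exists_representative_of_mem_eigenspaceOf hf
  have hFL : MemLp F 2 (volume.restrict (exteriorDomain α β)) :=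
    (memLp_congr_ae hF).2 (Lp.memLp f)
  have hleft : ∀ x, x < β 0 →
      planeWave (-z) (β 0) * F (β 0) = planeWave (-z) x * F x := fun x hx =>
    hev x (β 0) hx (Set.Ioo_subset_Iio_self.trans h.Iio_subset)
  have hright : ∀ x, α (Fin.last m) < x →
      planeWave (-z) x * F x = planeWave (-z) (α (Fin.last m)) * F (α (Fin.last m)) := fun x hx =>
    hev _ x hx (Set.Ioo_subset_Ioi_self.trans h.Ioi_subset)
  have hc0 : c ≠ 0 := by
    rintro rfl
    simp at hc
  have h0 : F (β 0) = 0 := by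
    by_contra hne
    have hne' : F (α (Fin.last m)) ≠ 0 := hcoup ▸ mul_ne_zero hc0 hne
    -- The sign of `z.im` selects the half-line on which the solution does not decay towards
    -- infinity; `c ≠ 0` makes the boundary value there nonzero too.
    rcases le_total 0 z.im with hz | hz
    · refine not_memLp_of_le_norm (norm_pos_iff.2 hne) measurableSet_Iio h.Iio_subset
        Real.volume_Iio (fun x hx => ?_) hFL
      exact norm_le_of_planeWave_neg_mul_eq (hleft x hx)
        (mul_nonneg hz (sub_nonneg.2 (le_of_lt hx)))
    · refine not_memLp_of_le_norm (norm_pos_iff.2 hne') measurableSet_Ioi h.Ioi_subset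
        Real.volume_Ioi (fun x hx => ?_) hFL
      exact norm_le_of_planeWave_neg_mul_eq (hright x hx).symm
        (mul_nonneg_of_nonpos_of_nonpos hz (sub_nonpos.2 (le_of_lt hx)))
  have h1 : F (α (Fin.last m)) = 0 := by rw [← hcoup, h0, mul_zero]
  refine ⟨F, hF, fun x hx => ?_, fun x hx => ?_,
    fun k => planeWave (-z) (α k.castSucc) * F (α k.castSucc), fun k => ⟨fun x hx => ?_, ?_⟩⟩
  · have := hleft x hx
    rw [h0, mul_zero] at this
    exact (mul_eq_zero.1 this.symm).resolve_left (planeWave_ne_zero _ _)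
  · have := hright x hx
    rw [h1, mul_zero] at this
    exact (mul_eq_zero.1 this).resolve_left (planeWave_ne_zero _ _)
  · change F x = planeWave (-z) (α k.castSucc) * F (α k.castSucc) * planeWave z x
    rw [← hev _ x hx.1 ((Set.Ioo_subset_Ioo_right hx.2.le).trans (h.gap_subset k)),
      mul_right_comm, planeWave_neg_mul, one_mul]
  · intro hne
    -- A nonzero coefficient means `F (α k.castSucc) ≠ 0`, so this value cancels from conservation
    -- across the whole component and leaves `planeWave z ℓ_k = 1`.
    have hev' := hev _ _ (h.α_lt_β_succ k) (h.gap_subset k)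
    rw [hper k] at hev'
    have e := mul_right_cancel₀ (mul_ne_zero_iff.1 hne).2 hev'
    rw [gapLength, ← planeWave_eq_one_iff, sub_eq_add_neg, planeWave_add]
    have e1 : planeWave (-z) (α k.castSucc) = planeWave z (-α k.castSucc) := by
      simp [planeWave]
    rw [← e1, ← e, mul_comm, planeWave_neg_mul]

/-! ### Plane waves on the bounded components -/

theorem memLp_gap_planeWave {m : ℕ} (α β : Fin (m + 1) → ℝ) (z : ℂ) (k : Fin m) :
    MemLp ((Set.Icc (α k.castSucc) (β k.succ)).indicator (planeWave z)) 2
      (volume.restrict (exteriorDomain α β)) := by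
  refine MemLp.mono_measure Measure.restrict_le_self ?_
  rw [memLp_indicator_iff_restrict measurableSet_Icc]
  obtain ⟨C, hC⟩ := isCompact_Icc.exists_bound_of_continuousOn
    (continuous_planeWave z).continuousOn (s := Set.Icc (α k.castSucc) (β k.succ))
  refine MemLp.of_bound (continuous_planeWave z).aestronglyMeasurable C ?_
  filter_upwards [ae_restrict_mem measurableSet_Icc] with x hx using hC x hx

/-- The plane wave `exp (2πi z x)` cut off to the bounded component `(α k, β (k + 1))`. -/
def gapMode {m : ℕ} (α β : Fin (m + 1) → ℝ) (z : ℂ) (k : Fin m) : L2Ext α β :=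
  (memLp_gap_planeWave α β z k).toLp

theorem coeFn_gapMode {m : ℕ} (α β : Fin (m + 1) → ℝ) (z : ℂ) (k : Fin m) :
    gapMode α β z k =ᵐ[volume.restrict (exteriorDomain α β)]
      (Set.Icc (α k.castSucc) (β k.succ)).indicator (planeWave z) :=
  MemLp.coeFn_toLp _

/-- The indicator of the closed interval is itself a valid representative: it carries the one-sided
boundary values at both ends, and these agree because `ℓ_k z` is an integer. -/
theorem gapMode_mem_eigenspaceOf {m : ℕ} {α β : Fin (m + 1) → ℝ} (h : Interlaced α β) (c : ℂ)
    {z : ℂ} {k : Fin m} (hk : ∃ j : ℤ, (gapLength α β k : ℂ) * z = j) :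
    gapMode α β z k ∈ eigenspaceOf (momentumOperator α β (decouplingMatrix m c)) z := by
  rw [mem_eigenspaceOf_iff_mem_graph, mem_graph_momentumOperator_iff]
  have hzero : ∀ x, x ∉ Set.Icc (α k.castSucc) (β k.succ) →
      (Set.Icc (α k.castSucc) (β k.succ)).indicator (planeWave z) x = 0 := fun x hx =>
    Set.indicator_of_notMem hx _
  have hl : ∀ x, x ≤ β 0 → x ∉ Set.Icc (α k.castSucc) (β k.succ) := fun x hx hmem =>
    absurd (h.β_zero_lt_α k.castSucc) (not_lt.2 (hmem.1.trans hx))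
  have hr : ∀ x, α (Fin.last m) ≤ x → x ∉ Set.Icc (α k.castSucc) (β k.succ) := fun x hx hmem =>
    absurd (h.β_lt_α_last k.succ) (not_lt.2 (hx.trans hmem.2))
  have hac0 : ∀ a b, AbsolutelyContinuousOnInterval (fun _ : ℝ => (0 : ℂ)) a b :=
    (contDiff_const (n := 1)).absolutelyContinuousOnInterval
  refine ⟨_, (coeFn_gapMode α β z k).symm, ?_, ?_, fun l => ?_, ?_⟩
  · refine h.absolutelyContinuousOnInterval_of_pieces
      (M := fun l => if l = k then planeWave z else fun _ => 0) hac0 hac0 (fun l a b => ?_)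
      (fun x hx => (hzero x (hl x hx)).symm) (fun x hx => (hzero x (hr x hx)).symm)
      (fun l x hx => ?_)
    · split_ifs
      · exact (contDiff_planeWave z).absolutelyContinuousOnInterval a b
      · exact hac0 a b
    · split_ifs with hlk
      · subst hlk
        rw [Set.indicator_of_mem hx]
      · exact (hzero x (Set.disjoint_left.1 (h.disjoint_gaps hlk) hx)).symm
  · filter_upwards [Lp.coeFn_zero ℂ 2 (volume.restrict (exteriorDomain α β)),
      ae_restrict_mem (isOpen_exteriorDomain α β).measurableSet] with x hx hmem
    rw [hx, Pi.zero_apply, zero_add]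
    by_cases hxk : x ∈ Set.Ioo (α k.castSucc) (β k.succ)
    · rw [Set.indicator_of_mem (Set.Ioo_subset_Icc_self hxk), ← mul_assoc]
      refine (hasDerivAt_planeWave z x).congr_of_eventuallyEq ?_
      filter_upwards [Ioo_mem_nhds hxk.1 hxk.2] with y hy
      rw [Set.indicator_of_mem (Set.Ioo_subset_Icc_self hy)]
    · have hxn : x ∉ Set.Icc (α k.castSucc) (β k.succ) := fun hx' =>
        hxk (h.mem_gap_of_mem_Icc hx' hmem)
      rw [hzero x hxn, mul_zero, mul_zero]
      refine (hasDerivAt_const x (0 : ℂ)).congr_of_eventuallyEq ?_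
      filter_upwards [isClosed_Icc.isOpen_compl.mem_nhds hxn] with y hy using hzero y hy
  · by_cases hlk : l = k
    · subst hlk
      rw [Set.indicator_of_mem (Set.right_mem_Icc.2 (h.α_lt_β_succ l).le),
        Set.indicator_of_mem (Set.left_mem_Icc.2 (h.α_lt_β_succ l).le)]
      rw [← sub_add_cancel (β l.succ) (α l.castSucc), planeWave_add]
      rw [gapLength, ← planeWave_eq_one_iff] at hk
      rw [hk, one_mul]
    · have hd := Set.disjoint_left.1 (h.disjoint_gaps hlk)
      rw [hzero _ (hd (Set.right_mem_Icc.2 (h.α_lt_β_succ l).le)),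
        hzero _ (hd (Set.left_mem_Icc.2 (h.α_lt_β_succ l).le))]
  · rw [hzero _ (hl _ le_rfl), hzero _ (hr _ le_rfl), mul_zero]

/-- The inner product with a plane wave on a bounded component. -/
theorem inner_gapMode {m : ℕ} {α β : Fin (m + 1) → ℝ} (h : Interlaced α β) (z : ℂ) (k : Fin m)
    (f : L2Ext α β) : inner ℂ (gapMode α β z k) f =
      ∫ x in Set.Ioo (α k.castSucc) (β k.succ), star (planeWave z x) * f x := by
  rw [L2.inner_def]
  have e : ∀ᵐ x ∂(volume.restrict (exteriorDomain α β)), inner ℂ (gapMode α β z k x) (f x) =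
      (Set.Icc (α k.castSucc) (β k.succ)).indicator (fun x => star (planeWave z x) * f x) x := by
    filter_upwards [coeFn_gapMode α β z k] with x hx
    rw [hx]
    by_cases hmem : x ∈ Set.Icc (α k.castSucc) (β k.succ)
    · rw [Set.indicator_of_mem hmem, Set.indicator_of_mem hmem, RCLike.inner_apply', mul_comm]
      simp [mul_comm]
    · rw [Set.indicator_of_notMem hmem, Set.indicator_of_notMem hmem, inner_zero_left]
  rw [integral_congr_ae e, integral_indicator measurableSet_Icc,
    Measure.restrict_restrict measurableSet_Icc]
  congr 2
  refine Set.Subset.antisymm (fun x hx => h.mem_gap_of_mem_Icc hx.1 hx.2) fun x hx => ?_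
  exact ⟨Set.Ioo_subset_Icc_self hx, h.gap_subset k hx⟩

theorem gapMode_ne_zero {m : ℕ} {α β : Fin (m + 1) → ℝ} (h : Interlaced α β) (z : ℂ) (k : Fin m) :
    gapMode α β z k ≠ 0 := by
  intro h0
  have h1 : ∀ᵐ x ∂(volume.restrict (Set.Ioo (α k.castSucc) (β k.succ))), False := by
    have h2 := ae_mono (Measure.restrict_mono (h.gap_subset k) le_rfl)
      ((coeFn_gapMode α β z k).symm.trans (Lp.eq_zero_iff_ae_eq_zero.1 h0))
    filter_upwards [h2, ae_restrict_mem measurableSet_Ioo] with x hx hmem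
    rw [Set.indicator_of_mem (Set.Ioo_subset_Icc_self hmem)] at hx
    exact planeWave_ne_zero _ _ hx
  rw [eventually_false_iff_eq_bot, ae_eq_bot, Measure.restrict_eq_zero, Real.volume_Ioo,
    ENNReal.ofReal_eq_zero] at h1
  linarith [h.α_lt_β_succ k]

/-- Modes on different components have disjoint supports, hence are orthogonal. -/
theorem linearIndependent_gapMode {m : ℕ} {α β : Fin (m + 1) → ℝ} (h : Interlaced α β) (z : ℂ) :
    LinearIndependent ℂ (gapMode α β z) := by
  refine linearIndependent_of_ne_zero_of_inner_eq_zero (𝕜 := ℂ) (gapMode_ne_zero h z) ?_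
  intro k l hkl
  rw [inner_gapMode h]
  refine (setIntegral_congr_ae (g := fun _ => 0) measurableSet_Ioo ?_).trans (by simp)
  have h2 := ae_mono (Measure.restrict_mono (h.gap_subset k) le_rfl) (coeFn_gapMode α β z l)
  filter_upwards [(ae_restrict_iff' measurableSet_Ioo).1 h2] with x hx hmem
  rw [hx hmem, Set.indicator_of_notMem, mul_zero]
  exact Set.disjoint_left.1 (h.disjoint_gaps hkl) (Set.Ioo_subset_Icc_self hmem)

theorem eigenspaceOf_momentumOperator {m : ℕ} {α β : Fin (m + 1) → ℝ} (h : Interlaced α β)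
    {c : ℂ} (hc : ‖c‖ = 1) (z : ℂ) :
    eigenspaceOf (momentumOperator α β (decouplingMatrix m c)) z =
      Submodule.span ℂ (Set.range fun k : {k : Fin m | ∃ j : ℤ, (gapLength α β k : ℂ) * z = j} =>
        gapMode α β z k) := by
  refine le_antisymm (fun f hf => ?_) (Submodule.span_le.2 ?_)
  · obtain ⟨F, hF, h0, h1, w, hw⟩ := exists_eigenfunction h hc hf
    -- The sum runs over all components; coefficients of components with `ℓ_k z` not an integer
    -- vanish.
    have e : f = ∑ k, w k • gapMode α β z k := by
      refine Lp.ext ?_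
      have hsm : ∀ᵐ x ∂(volume.restrict (exteriorDomain α β)), ∀ k,
          (w k • gapMode α β z k) x =
            w k * (Set.Icc (α k.castSucc) (β k.succ)).indicator (planeWave z) x := by
        rw [ae_all_iff]
        intro k
        filter_upwards [Lp.coeFn_smul (w k) (gapMode α β z k), coeFn_gapMode α β z k] with x hx hx'
        rw [hx, Pi.smul_apply, hx', smul_eq_mul]
      filter_upwards [hF, hsm, Lp.coeFn_finsetSum Finset.univ fun k => w k • gapMode α β z k,
        ae_restrict_mem (isOpen_exteriorDomain α β).measurableSet] with x hx hx' hs hmem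
      rw [← hx, hs, Finset.sum_apply, Finset.sum_congr rfl fun k _ => hx' k]
      rcases mem_pieces_of_mem_exteriorDomain hmem with hp | hp | ⟨l, hp⟩
      · rw [h0 x hp, Finset.sum_eq_zero]
        intro k _
        rw [Set.indicator_of_notMem, mul_zero]
        exact fun hm => absurd (hm.1.trans_lt hp) (not_lt.2 (h.β_zero_lt_α _).le)
      · rw [h1 x hp, Finset.sum_eq_zero]
        intro k _
        rw [Set.indicator_of_notMem, mul_zero]
        exact fun hm => absurd (hp.trans_le hm.2) (not_lt.2 (h.β_lt_α_last _).le)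
      · rw [(hw l).1 x hp, Finset.sum_eq_single l,
          Set.indicator_of_mem (Set.Ioo_subset_Icc_self hp)]
        · intro k _ hkl
          rw [Set.indicator_of_notMem, mul_zero]
          exact Set.disjoint_left.1 (h.disjoint_gaps hkl.symm) (Set.Ioo_subset_Icc_self hp)
        · simp
    rw [e]
    refine Submodule.sum_mem _ fun k _ => ?_
    by_cases hk : w k = 0
    · rw [hk, zero_smul]
      exact Submodule.zero_mem _
    · exact Submodule.smul_mem _ _ (Submodule.subset_span ⟨⟨k, (hw k).2 hk⟩, rfl⟩)
  · rintro _ ⟨k, rfl⟩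
    exact gapMode_mem_eigenspaceOf h c k.2

theorem eigenMultiplicity_momentumOperator {m : ℕ} {α β : Fin (m + 1) → ℝ} (h : Interlaced α β)
    {c : ℂ} (hc : ‖c‖ = 1) (z : ℂ) :
    eigenMultiplicity (momentumOperator α β (decouplingMatrix m c)) z =
      {k : Fin m | ∃ j : ℤ, (gapLength α β k : ℂ) * z = j}.encard := by
  have hli := (linearIndependent_gapMode h z).comp
    (Subtype.val : {k : Fin m | ∃ j : ℤ, (gapLength α β k : ℂ) * z = j} → Fin m)
    Subtype.val_injective
  rw [eigenMultiplicity, eigenspaceOf_momentumOperator h hc]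
  have := rank_span hli
  rw [Cardinal.mk_range_eq _ hli.injective] at this
  -- `Set.encard` unfolds to `Cardinal.toENat` of the cardinality of the index set.
  exact (congrArg _ this).trans rfl

theorem mem_pointSpectrumOf_momentumOperator_iff {m : ℕ} {α β : Fin (m + 1) → ℝ}
    (h : Interlaced α β) {c : ℂ} (hc : ‖c‖ = 1) (z : ℂ) :
    z ∈ pointSpectrumOf (momentumOperator α β (decouplingMatrix m c)) ↔
      ∃ k : Fin m, ∃ j : ℤ, (gapLength α β k : ℂ) * z = j := by
  rw [pointSpectrumOf, Set.mem_ofPred_eq, eigenspaceOf_momentumOperator h hc, ne_eq,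
    Submodule.span_eq_bot]
  constructor
  · intro hne
    by_contra! hk
    refine hne ?_
    rintro _ ⟨⟨k, j, hj⟩, rfl⟩
    exact absurd hj (hk k j)
  · rintro ⟨k, hk⟩ h0
    exact gapMode_ne_zero h z k (h0 _ ⟨⟨k, hk⟩, rfl⟩)

theorem Interlaced.gapLength_pos {m : ℕ} {α β : Fin (m + 1) → ℝ} (h : Interlaced α β)
    (k : Fin m) : 0 < gapLength α β k := sub_pos.2 (h.α_lt_β_succ k)

/-- Here `z` is an arbitrary complex number: its reality follows from `ℓ_k z` being an integer with
`ℓ_k` real and nonzero, not from selfadjointness. -/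
theorem pointSpectrumOf_momentumOperator {m : ℕ} {α β : Fin (m + 1) → ℝ}
    (h : Interlaced α β) {c : ℂ} (hc : ‖c‖ = 1) :
    pointSpectrumOf (momentumOperator α β (decouplingMatrix m c)) =
      (fun t : ℝ => (t : ℂ)) '' (⋃ k : Fin m,
        Set.range fun j : ℤ => 1 / gapLength α β k * (j : ℝ)) := by
  ext z
  rw [mem_pointSpectrumOf_momentumOperator_iff h hc]
  constructor
  · rintro ⟨k, j, hj⟩
    have hl : (gapLength α β k : ℂ) ≠ 0 := by exact_mod_cast (h.gapLength_pos k).ne'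
    refine ⟨_, Set.mem_iUnion.2 ⟨k, j, rfl⟩, ?_⟩
    push_cast
    rw [← hj]
    field_simp
  · rintro ⟨t, ht, rfl⟩
    obtain ⟨k, j, rfl⟩ := Set.mem_iUnion.1 ht
    have hl : (gapLength α β k : ℂ) ≠ 0 := by exact_mod_cast (h.gapLength_pos k).ne'
    refine ⟨k, j, ?_⟩
    push_cast
    field_simp

theorem eigenspaceOf_momentumOperator_eq_bot {m : ℕ} {α β : Fin (m + 1) → ℝ}
    (h : Interlaced α β) {c : ℂ} (hc : ‖c‖ = 1) {z : ℂ} (hz : z.im ≠ 0) :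
    eigenspaceOf (momentumOperator α β (decouplingMatrix m c)) z = ⊥ := by
  by_contra hne
  have hmem : z ∈ pointSpectrumOf (momentumOperator α β (decouplingMatrix m c)) := hne
  rw [pointSpectrumOf_momentumOperator h hc] at hmem
  obtain ⟨t, -, rfl⟩ := hmem
  exact hz (Complex.ofReal_im t)

/-! ### Density of the eigenvalues -/

/-- The contributing points are exactly `j / l` with `j` an integer in `[l x, l y]`. -/
theorem tsum_Icc_ite_exists_int {l : ℝ} (hl : 0 < l) (x y : ℝ)
    [∀ t : ℝ, Decidable (∃ j : ℤ, l * t = j)] :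
    ∑' t : Set.Icc x y, (if ∃ j : ℤ, l * (t : ℝ) = j then (1 : ℝ≥0∞) else 0) =
      ((Finset.Icc ⌈l * x⌉ ⌊l * y⌋).card : ℝ≥0∞) := by
  rw [tsum_subtype (Set.Icc x y) fun t : ℝ => if ∃ j : ℤ, l * t = j then (1 : ℝ≥0∞) else 0]
  have hinj : Function.Injective fun j : ℤ => (j : ℝ) / l := fun i j hij => by
    simpa [div_left_inj' hl.ne'] using hij
  have hmem : ∀ j : ℤ, j ∈ Finset.Icc ⌈l * x⌉ ⌊l * y⌋ ↔ (j : ℝ) / l ∈ Set.Icc x y := fun j => by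
    rw [Finset.mem_Icc, Int.ceil_le, Int.le_floor, Set.mem_Icc, le_div_iff₀ hl, div_le_iff₀ hl,
      mul_comm x, mul_comm y]
  rw [tsum_eq_sum (s := (Finset.Icc ⌈l * x⌉ ⌊l * y⌋).map ⟨_, hinj⟩), Finset.sum_map,
    Finset.sum_congr rfl (g := fun _ => 1)]
  · simp
  · intro j hj
    have hex : ∃ i : ℤ, l * ((j : ℝ) / l) = i := ⟨j, mul_div_cancel₀ _ hl.ne'⟩
    rw [Function.Embedding.coeFn_mk, Set.indicator_of_mem ((hmem j).1 hj), if_pos hex]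
  · intro t ht
    by_cases hxy : t ∈ Set.Icc x y
    · rw [Set.indicator_of_mem hxy, if_neg]
      rintro ⟨j, hj⟩
      have e : (j : ℝ) / l = t := by rw [← hj, mul_div_cancel_left₀ _ hl.ne']
      exact ht (Finset.mem_map.2 ⟨j, (hmem j).2 (by rwa [e]), e⟩)
    · rw [Set.indicator_of_notMem hxy]

theorem card_Icc_ceil_floor_sub_le {u v : ℝ} (huv : u ≤ v) :
    |((Finset.Icc ⌈u⌉ ⌊v⌋).card : ℝ) - (v - u)| ≤ 1 := by
  -- The interval of integers may be empty, but `⌊v⌋ + 1 - ⌈u⌉` is never negative, so `toNat` does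
  -- not truncate.
  have h0 : ⌈u⌉ ≤ ⌊v⌋ + 1 := by
    rw [Int.ceil_le]
    push_cast
    linarith [Int.lt_floor_add_one v]
  have h1 : ((Finset.Icc ⌈u⌉ ⌊v⌋).card : ℝ) = ⌊v⌋ + 1 - ⌈u⌉ := by
    rw [Int.card_Icc]
    have : (((⌊v⌋ + 1 - ⌈u⌉).toNat : ℤ) : ℝ) = ((⌊v⌋ + 1 - ⌈u⌉ : ℤ) : ℝ) := by
      rw [Int.toNat_of_nonneg (by linarith)]
    push_cast at this
    exact this
  rw [h1, abs_le]
  constructor <;> linarith [Int.lt_floor_add_one v, Int.floor_le v, Int.le_ceil u,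
    Int.ceil_lt_add_one u]

/-- The count differs from `2 R l` by at most `1`, so the quotient differs from `l` by at most `1 /
(2 R)`, whatever the centre `a`. -/
theorem tendsto_card_Icc_div {l : ℝ} (hl : 0 < l) (a : ℝ) :
    Tendsto (fun R : ℝ => ((Finset.Icc ⌈l * (a - R)⌉ ⌊l * (a + R)⌋).card : ℝ) / (2 * R))
      atTop (𝓝 l) := by
  have hlim : Tendsto (fun R : ℝ => 1 / (2 * R)) atTop (𝓝 0) := by
    simp only [one_div]
    exact tendsto_inv_atTop_zero.comp (tendsto_id.const_mul_atTop two_pos)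
  rw [tendsto_iff_norm_sub_tendsto_zero]
  refine squeeze_zero' (Eventually.of_forall fun _ => norm_nonneg _) ?_ hlim
  filter_upwards [eventually_gt_atTop 0] with R hR
  have hle : l * (a - R) ≤ l * (a + R) := mul_le_mul_of_nonneg_left (by linarith) hl.le
  have h2 : (0 : ℝ) < 2 * R := by linarith
  have e : ((Finset.Icc ⌈l * (a - R)⌉ ⌊l * (a + R)⌋).card : ℝ) / (2 * R) - l =
      (((Finset.Icc ⌈l * (a - R)⌉ ⌊l * (a + R)⌋).card : ℝ) -
        (l * (a + R) - l * (a - R))) / (2 * R) := by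
    field_simp
    ring
  rw [e, Real.norm_eq_abs, abs_div, abs_of_pos h2]
  exact div_le_div_of_nonneg_right (card_Icc_ceil_floor_sub_le hle) h2.le

theorem eigenMultiplicity_momentumOperator_ofReal {m : ℕ} {α β : Fin (m + 1) → ℝ}
    (h : Interlaced α β) {c : ℂ} (hc : ‖c‖ = 1) (t : ℝ) :
    eigenMultiplicity (momentumOperator α β (decouplingMatrix m c)) (t : ℂ) =
      {k : Fin m | ∃ j : ℤ, gapLength α β k * t = (j : ℝ)}.encard := by
  rw [eigenMultiplicity_momentumOperator h hc]
  congr 1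
  ext k
  refine exists_congr fun j => ?_
  norm_cast

/-- The multiplicity is a sum of indicators over `k`; exchanging the sums over `t` and `k` leaves
one lattice count per component. -/
theorem eigenvalueCount_momentumOperator {m : ℕ} {α β : Fin (m + 1) → ℝ} (h : Interlaced α β)
    {c : ℂ} (hc : ‖c‖ = 1) (x y : ℝ) :
    eigenvalueCount (momentumOperator α β (decouplingMatrix m c)) x y =
      ENNReal.ofReal (∑ k : Fin m,
        ((Finset.Icc ⌈gapLength α β k * x⌉ ⌊gapLength α β k * y⌋).card : ℝ)) := by
  classical
  have hs : ∀ t : ℝ, ((eigenMultiplicity (momentumOperator α β (decouplingMatrix m c))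
      (t : ℂ) : ℕ∞) : ℝ≥0∞) =
        ∑ k : Fin m, if ∃ j : ℤ, gapLength α β k * t = j then (1 : ℝ≥0∞) else 0 := fun t => by
    rw [eigenMultiplicity_momentumOperator_ofReal h hc, Set.encard_eq_coe_toFinset_card,
      ENat.toENNReal_coe, Finset.sum_boole]
    congr 2
    ext k
    simp
  rw [eigenvalueCount]
  simp_rw [hs]
  rw [Summable.tsum_finsetSum fun _ _ => ENNReal.summable,
    ENNReal.ofReal_sum_of_nonneg fun _ _ => Nat.cast_nonneg _]
  refine Finset.sum_congr rfl fun k _ => ?_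
  rw [tsum_Icc_ite_exists_int (h.gapLength_pos k), ENNReal.ofReal_natCast]

theorem tendsto_eigenvalueCount_momentumOperator {m : ℕ} {α β : Fin (m + 1) → ℝ}
    (h : Interlaced α β) {c : ℂ} (hc : ‖c‖ = 1) (a : ℝ) :
    Tendsto (fun R : ℝ =>
      eigenvalueCount (momentumOperator α β (decouplingMatrix m c)) (a - R) (a + R) /
        ENNReal.ofReal (2 * R)) atTop (𝓝 (ENNReal.ofReal (∑ k : Fin m, gapLength α β k))) := by
  have hlim := ENNReal.tendsto_ofReal
    (tendsto_finsetSum Finset.univ fun k _ => tendsto_card_Icc_div (h.gapLength_pos k) a)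
  refine hlim.congr' ?_
  filter_upwards [eventually_gt_atTop 0] with R hR
  rw [eigenvalueCount_momentumOperator h hc, ← Finset.sum_div,
    ENNReal.ofReal_div_of_pos (by linarith)]

/-! ### The continuous subspace -/

/-- Completeness of the exponentials on an interval. -/
theorem ae_eq_zero_of_integral_planeWave_eq_zero {a b : ℝ} (hab : a < b) {f : ℝ → ℂ}
    (hf : MemLp f 2 (volume.restrict (Set.Ioc a b)))
    (h : ∀ j : ℤ, ∫ x in Set.Ioc a b, star (planeWave (j / (b - a)) x) * f x = 0) :
    f =ᵐ[volume.restrict (Set.Ioc a b)] 0 := by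
  have hcoef : ∀ j : ℤ, fourierCoeffOn hab f j = 0 := by
    intro j
    rw [fourierCoeffOn_eq_integral, intervalIntegral.integral_of_le hab.le]
    refine (congrArg _ ?_).trans (smul_zero (1 / (b - a)))
    rw [← h j]
    refine integral_congr_ae (Eventually.of_forall fun x => ?_)
    simp only [fourier_coe_apply, smul_eq_mul, planeWave]
    congr 1
    rw [Complex.star_def, ← Complex.exp_conj]
    congr 1
    simp only [map_mul, map_div₀, map_sub, Complex.conj_ofReal, Complex.conj_I, map_intCast,
      map_ofNat]
    push_cast
    ring
  -- Parseval: all Fourier coefficients vanish, so the integral of `‖f‖ ^ 2` does.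
  have hsum := hasSum_sq_fourierCoeffOn hab hf
  simp only [hcoef, norm_zero, ne_eq, OfNat.ofNat_ne_zero, not_false_eq_true, zero_pow] at hsum
  have h0 := hsum.unique hasSum_zero
  rw [smul_eq_zero, or_iff_right (inv_ne_zero (sub_pos.2 hab).ne'),
    intervalIntegral.integral_of_le hab.le, integral_eq_zero_iff_of_nonneg
      (fun x => by positivity) hf.norm.integrable_sq] at h0
  filter_upwards [h0] with x hx
  simpa using hx

/-- Orthogonality to the modes with `z = j / ℓ_k`, for all integers `j`, kills every Fourier
coefficient on the component. Conversely all eigenvectors are supported in the bounded components.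
-/
theorem mem_continuousSubspace_iff {m : ℕ} {α β : Fin (m + 1) → ℝ} (h : Interlaced α β)
    {c : ℂ} (hc : ‖c‖ = 1) (f : L2Ext α β) :
    f ∈ continuousSubspace (momentumOperator α β (decouplingMatrix m c)) ↔
      ∀ k : Fin m, ∀ᵐ x ∂(volume.restrict (Set.Ioo (α k.castSucc) (β k.succ))), f x = 0 := by
  constructor
  · intro hf k
    have hl : (β k.succ - α k.castSucc : ℂ) ≠ 0 := by
      exact_mod_cast (h.gapLength_pos k).ne'
    have hL : MemLp f 2 (volume.restrict (Set.Ioo (α k.castSucc) (β k.succ))) :=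
      (Lp.memLp f).mono_measure (Measure.restrict_mono (h.gap_subset k) le_rfl)
    rw [restrict_Ioo_eq_restrict_Ioc] at hL ⊢
    refine ae_eq_zero_of_integral_planeWave_eq_zero (h.α_lt_β_succ k) hL fun j => ?_
    rw [← restrict_Ioo_eq_restrict_Ioc, ← inner_gapMode h]
    refine (Submodule.mem_orthogonal _ _).1 hf _ (Submodule.mem_iSup_of_mem _
      (gapMode_mem_eigenspaceOf h c ⟨j, ?_⟩))
    rw [gapLength]
    push_cast
    field_simp
  · intro hf
    refine (Submodule.mem_orthogonal _ _).2 fun u hu => ?_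
    have hle : (⨆ z, eigenspaceOf (momentumOperator α β (decouplingMatrix m c)) z) ≤
        (Submodule.span ℂ {f})ᗮ := by
      refine iSup_le fun z => ?_
      rw [eigenspaceOf_momentumOperator h hc, Submodule.span_le]
      rintro _ ⟨k, rfl⟩
      refine Submodule.mem_orthogonal_singleton_iff_inner_left.2 ?_
      rw [inner_gapMode h]
      refine (integral_congr_ae (g := fun _ => 0) ?_).trans (by simp)
      filter_upwards [hf k] with x hx
      rw [hx, mul_zero]
    exact Submodule.mem_orthogonal_singleton_iff_inner_left.1 (hle hu)

/-! ### Real points are in the continuous spectrum -/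

/-- The resonant source: the amplitude `(1 + x ^ 2) ^ (-1/2)` is square integrable, yet its
primitive `arsinh` is unbounded. -/
theorem memLp_indicator_planeWave_mul_inv_sqrt (t : ℝ) {s : Set ℝ} (hs : MeasurableSet s) :
    MemLp (s.indicator fun x => planeWave t x * ((√(1 + x ^ 2))⁻¹ : ℝ)) 2 volume := by
  refine MemLp.indicator hs ?_
  have hcont : Continuous fun x : ℝ => planeWave t x * ((√(1 + x ^ 2))⁻¹ : ℝ) := by
    refine (continuous_planeWave t).mul (Complex.continuous_ofReal.comp ?_)
    refine Continuous.inv₀ (by fun_prop) fun x => ?_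
    positivity
  rw [memLp_two_iff_integrable_sq_norm hcont.aestronglyMeasurable]
  refine integrable_inv_one_add_sq.congr (Eventually.of_forall fun x => ?_)
  have h0 : (0 : ℝ) ≤ 1 + x ^ 2 := by positivity
  have h1 : ‖planeWave t x‖ = 1 := by simp [norm_planeWave]
  simp only [norm_mul, h1, one_mul, Complex.norm_real, norm_inv, inv_pow, Real.norm_eq_abs, sq_abs,
    Real.sq_sqrt h0]

/-- The source oscillates at the frequency `t` itself, so any solution on the left half-line has
modulus `‖C + 2πi arsinh x‖`. This grows as `x → -∞`, contradicting square integrability. -/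
theorem ofReal_notMem_resolventSetOf {m : ℕ} {α β : Fin (m + 1) → ℝ} (h : Interlaced α β)
    {c : ℂ} (hc : ‖c‖ = 1) (t : ℝ) :
    (t : ℂ) ∉ resolventSetOf (partIn (momentumOperator α β (decouplingMatrix m c))
      (continuousSubspace (momentumOperator α β (decouplingMatrix m c)))) := by
  intro ht
  have hgL := (memLp_indicator_planeWave_mul_inv_sqrt t
    (measurableSet_Iio (a := β 0))).mono_measure
      (Measure.restrict_le_self (s := exteriorDomain α β))
  have hg := hgL.coeFn_toLp
  have hgK : hgL.toLp ∈ continuousSubspace (momentumOperator α β (decouplingMatrix m c)) := by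
    rw [mem_continuousSubspace_iff h hc]
    intro k
    filter_upwards [ae_mono (Measure.restrict_mono (h.gap_subset k) le_rfl) hg,
      ae_restrict_mem measurableSet_Ioo] with x hx hmem
    rw [hx, Set.indicator_of_notMem]
    exact fun hx' => absurd (hmem.1.trans hx') (not_lt.2 (h.β_zero_lt_α _).le)
  obtain ⟨f, hf⟩ := exists_mem_graph_of_mem_resolventSetOf ht ⟨hgL.toLp, hgK⟩
  rw [mem_graph_partIn_iff] at hf
  obtain ⟨F, hF, hac, hd, -⟩ := mem_graph_momentumOperator_iff.1 hf
  set U : ℝ → ℂ := fun x => 2 * Real.pi * Complex.I * (Real.arsinh x : ℂ) with hU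
  have hUc : ContDiff ℝ 1 U :=
    contDiff_const.mul (Complex.ofRealCLM.contDiff.comp Real.contDiff_arsinh)
  set C : ℂ := planeWave (-t) (β 0) * F (β 0) - U (β 0) with hC
  have hsol : ∀ x < β 0, planeWave (-t) x * F x = C + U x := by
    intro x hx
    have := planeWave_neg_mul_sub_eq_of_solution (U := U) hx
      (Set.Ioo_subset_Iio_self.trans h.Iio_subset) hac hd hUc ?_
    · rw [hC, this]
      ring
    · filter_upwards [hg] with y hy hmem
      rw [hy, Set.indicator_of_mem (show y ∈ Set.Iio (β 0) from hmem.2), 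
        ← mul_assoc (planeWave _ _), planeWave_neg_mul, one_mul]
      exact ((Real.hasDerivAt_arsinh y).ofReal_comp).const_mul _
  -- Below `sinh (-(1 + ‖C‖))` one has `|arsinh x| ≥ 1 + ‖C‖`, hence `‖F x‖ ≥ 2π (1 + ‖C‖) - ‖C‖ ≥
  -- 1`.
  refine not_memLp_of_le_norm (F := F) (t := Set.Iio (min (β 0) (Real.sinh (-(1 + ‖C‖)))))
    one_pos measurableSet_Iio ((Set.Iio_subset_Iio (min_le_left _ _)).trans h.Iio_subset)
    Real.volume_Iio (fun x hx => ?_) ((memLp_congr_ae hF).2 (Lp.memLp _))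
  have hx1 : x < β 0 := hx.trans_le (min_le_left _ _)
  have hx2 : Real.arsinh x ≤ -(1 + ‖C‖) := by
    rw [← Real.arsinh_sinh (-(1 + ‖C‖)), Real.arsinh_le_arsinh]
    exact hx.le.trans (min_le_right _ _)
  have h1 : ‖planeWave (-t) x‖ = 1 := by simp [norm_planeWave]
  have h2 : ‖F x‖ = ‖U x - -C‖ := by
    rw [sub_neg_eq_add, add_comm, ← hsol x hx1, norm_mul, h1, one_mul]
  have h3 : ‖U x‖ = 2 * Real.pi * |Real.arsinh x| := by
    simp [hU, abs_of_pos Real.pi_pos]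
  have h4 := norm_sub_norm_le (U x) (-C)
  rw [← h2, h3, norm_neg] at h4
  have h5 : 1 + ‖C‖ ≤ |Real.arsinh x| := by
    rw [le_abs]
    right
    linarith
  nlinarith [Real.pi_gt_three, norm_nonneg C,
    mul_le_mul Real.pi_gt_three.le h5 (by positivity) Real.pi_pos.le]

/-! ### Square integrable solutions on the line -/

/-- The Cauchy–Schwarz inequality with a weight. -/
theorem lintegral_mul_sq_le {X : Type*} [MeasurableSpace X] (μ : Measure X) {k g : X → ℝ≥0∞}
    (hk : AEMeasurable k μ) (hg : AEMeasurable g μ) :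
    (∫⁻ x, k x * g x ∂μ) ^ 2 ≤ (∫⁻ x, k x ∂μ) * ∫⁻ x, k x * g x ^ 2 ∂μ := by
  have hhalf : ∀ a : ℝ≥0∞, (a ^ (1 / 2 : ℝ)) ^ (2 : ℝ) = a := fun a => by
    rw [← ENNReal.rpow_mul]
    norm_num
  have hsq : ∀ a : ℝ≥0∞, a ^ (1 / 2 : ℝ) * a ^ (1 / 2 : ℝ) = a := fun a => by
    rw [← sq, ← ENNReal.rpow_two, hhalf]
  -- Hölder for the factorisation `k g = k ^ (1/2) * (k ^ (1/2) g)`.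
  have hH := ENNReal.lintegral_mul_le_Lp_mul_Lq μ Real.HolderConjugate.two_two
    (hk.pow_const (1 / 2 : ℝ)) ((hk.pow_const (1 / 2 : ℝ)).mul hg)
  simp only [Pi.mul_apply, ENNReal.mul_rpow_of_nonneg _ _ zero_le_two, hhalf, ← mul_assoc, hsq,
    ENNReal.rpow_two] at hH
  calc (∫⁻ x, k x * g x ∂μ) ^ 2
      ≤ ((∫⁻ x, k x ∂μ) ^ (1 / 2 : ℝ) * (∫⁻ x, k x * g x ^ 2 ∂μ) ^ (1 / 2 : ℝ)) ^ 2 := by gcongr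
    _ = _ := by rw [mul_pow, ← ENNReal.rpow_two, ← ENNReal.rpow_two, hhalf, hhalf]

/-- Young's inequality `‖k ∗ g‖₂ ≤ ‖k‖₁ ‖g‖₂` for nonnegative functions on the line. -/
theorem lintegral_convolution_sq_le {k g : ℝ → ℝ≥0∞} (hk : Measurable k) (hg : Measurable g) :
    ∫⁻ x, (∫⁻ t, k (x - t) * g t) ^ 2 ≤ (∫⁻ s, k s) ^ 2 * ∫⁻ t, g t ^ 2 := by
  have hkm : Measurable fun p : ℝ × ℝ => k (p.1 - p.2) :=
    hk.comp (measurable_fst.sub measurable_snd)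
  have hgm : Measurable fun p : ℝ × ℝ => g p.2 ^ 2 := (hg.comp measurable_snd).pow_const 2
  -- Weighted Cauchy–Schwarz in `t`, then Tonelli; translation invariance gives the factor `∫ k`
  -- once in each step.
  calc ∫⁻ x, (∫⁻ t, k (x - t) * g t) ^ 2
      ≤ ∫⁻ x, (∫⁻ s, k s) * ∫⁻ t, k (x - t) * g t ^ 2 := by
        refine lintegral_mono fun x => ?_
        have hkx : Measurable fun t => k (x - t) := hk.comp (measurable_const.sub measurable_id)
        refine (lintegral_mul_sq_le volume hkx.aemeasurable hg.aemeasurable).trans_eq ?_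
        rw [lintegral_sub_left_eq_self k x]
    _ = (∫⁻ s, k s) * ∫⁻ t, ∫⁻ x, k (x - t) * g t ^ 2 := by
        rw [lintegral_const_mul _ (hkm.mul hgm).lintegral_prod_right,
          lintegral_lintegral_swap (hkm.mul hgm).aemeasurable]
    _ = (∫⁻ s, k s) * ∫⁻ t, (∫⁻ s, k s) * g t ^ 2 := by
        congr 1
        refine lintegral_congr fun t => ?_
        have hkt : Measurable fun x => k (x - t) := hk.comp (measurable_id.sub measurable_const)
        rw [lintegral_mul_const _ hkt,
          lintegral_sub_right_eq_self k t]
    _ = _ := by rw [lintegral_const_mul _ (hg.pow_const 2), ← mul_assoc, sq]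

/-- The kernel `exp (-2π |y| |s|)`. -/
def decayKernel (y s : ℝ) : ℝ≥0∞ := ENNReal.ofReal (Real.exp (-(2 * Real.pi * |y * s|)))

theorem measurable_decayKernel (y : ℝ) : Measurable (decayKernel y) := by
  unfold decayKernel
  fun_prop

theorem decayKernel_le_one (y s : ℝ) : decayKernel y s ≤ 1 := by
  rw [decayKernel, ENNReal.ofReal_le_one, Real.exp_le_one_iff]
  have := Real.pi_pos
  have : 0 ≤ 2 * Real.pi * |y * s| := by positivity
  linarith

theorem lintegral_decayKernel_ne_top {y : ℝ} (hy : y ≠ 0) : ∫⁻ s, decayKernel y s ≠ ∞ := by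
  have hr : 0 < 2 * Real.pi * |y| := by
    have := Real.pi_pos
    positivity
  have h1 : IntegrableOn (fun s => Real.exp (-(2 * Real.pi * |y * s|))) (Set.Iic 0) := by
    refine (integrableOn_exp_mul_Iic hr 0).congr_fun (fun s hs => ?_) measurableSet_Iic
    dsimp only
    rw [abs_mul, abs_of_nonpos (show s ≤ 0 from hs)]
    ring_nf
  have h2 : IntegrableOn (fun s => Real.exp (-(2 * Real.pi * |y * s|))) (Set.Ioi 0) := by
    refine (integrableOn_exp_mul_Ioi (neg_neg_of_pos hr) 0).congr_fun (fun s hs => ?_)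
      measurableSet_Ioi
    dsimp only
    rw [abs_mul, abs_of_pos (show 0 < s from hs)]
    ring_nf
  have h3 : Integrable (fun s => Real.exp (-(2 * Real.pi * |y * s|))) := by
    rw [← integrableOn_univ, ← Set.Iic_union_Ioi (a := (0 : ℝ))]
    exact h1.union h2
  have h4 := (hasFiniteIntegral_iff_ofReal
    (Eventually.of_forall fun s => (Real.exp_pos _).le)).1 h3.2
  exact h4.ne

/-- The sign condition says that `t` lies on the side of `x` from which the propagator to `x`
decays. -/
theorem enorm_planeWave_mul {z : ℂ} {x t : ℝ} (h : 0 ≤ z.im * (x - t)) :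
    ‖planeWave z x‖ₑ * ‖planeWave (-z) t‖ₑ = decayKernel z.im (x - t) := by
  rw [← enorm_mul, ← ofReal_norm, norm_mul, norm_planeWave, norm_planeWave, ← Real.exp_add,
    decayKernel, abs_of_nonneg h, Complex.neg_im]
  congr 2
  ring

/-- The source term of the equation `(planeWave (-z) F)' = 2πi planeWave (-z) g`. -/
def modulatedSource (z : ℂ) (g : ℝ → ℂ) (t : ℝ) : ℂ :=
  2 * Real.pi * Complex.I * (planeWave (-z) t * g t)

theorem enorm_modulatedSource (z : ℂ) (g : ℝ → ℂ) (t : ℝ) :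
    ‖modulatedSource z g t‖ₑ = ‖(2 * Real.pi : ℂ)‖ₑ * (‖planeWave (-z) t‖ₑ * ‖g t‖ₑ) := by
  rw [modulatedSource, enorm_mul, enorm_mul, enorm_mul]
  simp [← ofReal_norm]

theorem enorm_planeWave_mul_setLIntegral_le {z : ℂ} {g : ℝ → ℂ} (hg : Measurable g) {x : ℝ}
    {s : Set ℝ} (hs : MeasurableSet s) (h : ∀ t ∈ s, 0 ≤ z.im * (x - t)) :
    ‖planeWave z x‖ₑ * ∫⁻ t in s, ‖modulatedSource z g t‖ₑ ≤
      ‖(2 * Real.pi : ℂ)‖ₑ * ∫⁻ t, decayKernel z.im (x - t) * ‖g t‖ₑ := by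
  have hm : Measurable fun t => decayKernel z.im (x - t) * ‖g t‖ₑ :=
    ((measurable_decayKernel _).comp (measurable_const.sub measurable_id)).mul hg.enorm
  have hm' : Measurable (modulatedSource z g) :=
    ((continuous_planeWave (-z)).measurable.mul hg).const_mul _
  rw [← lintegral_const_mul _ hm'.enorm, ← lintegral_const_mul _ hm]
  refine (setLIntegral_mono' hs fun t ht => ?_).trans (setLIntegral_le_lintegral s _)
  rw [enorm_modulatedSource, ← enorm_planeWave_mul (h t ht)]
  exact le_of_eq (by ring)

/-- Finiteness is needed at every `x`, whereas the `L²` bound on the convolution gives it only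
almost everywhere. Weighted Cauchy–Schwarz with `decayKernel ≤ 1` bounds the square by `(∫ k) (∫ ‖g‖
^ 2)`. -/
theorem lintegral_decayKernel_mul_ne_top {y : ℝ} (hy : y ≠ 0) {g : ℝ → ℂ} (hg : Measurable g)
    (hg2 : ∫⁻ t, ‖g t‖ₑ ^ 2 ≠ ∞) (x : ℝ) : ∫⁻ t, decayKernel y (x - t) * ‖g t‖ₑ ≠ ∞ := by
  have hkx : Measurable fun t => decayKernel y (x - t) :=
    (measurable_decayKernel _).comp (measurable_const.sub measurable_id)
  have h1 := lintegral_mul_sq_le volume hkx.aemeasurable hg.enorm.aemeasurable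
  rw [lintegral_sub_left_eq_self (decayKernel y) x] at h1
  have h2 : ∫⁻ t, decayKernel y (x - t) * ‖g t‖ₑ ^ 2 ≤ ∫⁻ t, ‖g t‖ₑ ^ 2 :=
    lintegral_mono fun t => mul_le_of_le_one_left zero_le (decayKernel_le_one _ _)
  intro htop
  rw [htop] at h1
  have h3 := h1.trans (mul_le_mul_right h2 _)
  simp only [ne_eq, OfNat.ofNat_ne_zero, not_false_eq_true, ENNReal.top_pow, top_le_iff] at h3
  exact ENNReal.mul_ne_top (lintegral_decayKernel_ne_top hy) hg2 h3

theorem integrableOn_modulatedSource {z : ℂ} (hz : z.im ≠ 0) {g : ℝ → ℂ} (hg : Measurable g)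
    (hg2 : ∫⁻ t, ‖g t‖ₑ ^ 2 ≠ ∞) {x : ℝ} {s : Set ℝ} (hs : MeasurableSet s)
    (h : ∀ t ∈ s, 0 ≤ z.im * (x - t)) : IntegrableOn (modulatedSource z g) s := by
  have hm' : Measurable (modulatedSource z g) :=
    ((continuous_planeWave (-z)).measurable.mul hg).const_mul _
  refine ⟨hm'.aestronglyMeasurable, lt_top_iff_ne_top.2 fun htop => ?_⟩
  have h1 := enorm_planeWave_mul_setLIntegral_le hg hs h
  rw [htop, ENNReal.mul_top (enorm_ne_zero.2 (planeWave_ne_zero z x)), top_le_iff] at h1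
  exact ENNReal.mul_ne_top enorm_ne_top (lintegral_decayKernel_mul_ne_top hz hg hg2 x) h1

/-- For non-real `z` the source has a primitive `H` such that `planeWave z * H`, a solution of
`F' = 2πi (z F + g)`, is controlled by the convolution of `g` with an exponential kernel. -/
theorem exists_primitive_modulatedSource {z : ℂ} (hz : z.im ≠ 0) {g : ℝ → ℂ} (hg : Measurable g)
    (hg2 : ∫⁻ t, ‖g t‖ₑ ^ 2 ≠ ∞) :
    LocallyIntegrable (modulatedSource z g) ∧ ∃ H : ℝ → ℂ,
      (∀ a b, H b - H a = ∫ t in a..b, modulatedSource z g t) ∧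
      ∀ x, ‖planeWave z x * H x‖ₑ ≤
        ‖(2 * Real.pi : ℂ)‖ₑ * ∫⁻ t, decayKernel z.im (x - t) * ‖g t‖ₑ := by
  -- Integration starts from the infinite end where `planeWave (-z)` decays: `+∞` for negative
  -- `z.im`, `-∞` for positive.
  rcases lt_or_gt_of_ne hz with hneg | hpos
  · have hs : ∀ x, ∀ t ∈ Set.Ioi x, 0 ≤ z.im * (x - t) := fun x t ht =>
      mul_nonneg_of_nonpos_of_nonpos hneg.le (sub_nonpos.2 (le_of_lt ht))
    have hint : ∀ x, IntegrableOn (modulatedSource z g) (Set.Ioi x) := fun x =>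
      integrableOn_modulatedSource hz hg hg2 measurableSet_Ioi (hs x)
    refine ⟨fun x => ⟨_, Ioi_mem_nhds (sub_one_lt x), hint _⟩,
      fun x => -∫ t in Set.Ioi x, modulatedSource z g t, fun a b => ?_, fun x => ?_⟩
    · rw [← intervalIntegral.integral_Ioi_sub_Ioi' (hint a) (hint b)]
      ring
    · refine le_trans ?_ (enorm_planeWave_mul_setLIntegral_le hg measurableSet_Ioi (hs x))
      rw [enorm_mul, enorm_neg]
      gcongr
      exact enorm_integral_le_lintegral_enorm _
  · have hs : ∀ x, ∀ t ∈ Set.Iic x, 0 ≤ z.im * (x - t) := fun x t ht =>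
      mul_nonneg (le_of_lt hpos) (sub_nonneg.2 ht)
    have hint : ∀ x, IntegrableOn (modulatedSource z g) (Set.Iic x) := fun x =>
      integrableOn_modulatedSource hz hg hg2 measurableSet_Iic (hs x)
    refine ⟨fun x => ⟨_, Iic_mem_nhds (lt_add_one x), hint _⟩,
      fun x => ∫ t in Set.Iic x, modulatedSource z g t, fun a b => ?_, fun x => ?_⟩
    · exact intervalIntegral.integral_Iic_sub_Iic (hint a) (hint b)
    · refine le_trans ?_ (enorm_planeWave_mul_setLIntegral_le hg measurableSet_Iic (hs x))
      rw [enorm_mul]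
      gcongr
      exact enorm_integral_le_lintegral_enorm _

theorem eLpNorm_two_eq {X : Type*} [MeasurableSpace X] (μ : Measure X) (f : X → ℂ) :
    eLpNorm f 2 μ = (∫⁻ x, ‖f x‖ₑ ^ 2 ∂μ) ^ (1 / 2 : ℝ) := by
  rw [eLpNorm_eq_lintegral_rpow_enorm_toReal two_ne_zero ENNReal.ofNat_ne_top]
  simp

/-- The norm bound of the resolvent of `(1 / 2πi) d/dx` on the line. -/
def resolventBound (z : ℂ) : ℝ≥0∞ := ‖(2 * Real.pi : ℂ)‖ₑ * ∫⁻ s, decayKernel z.im s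

theorem resolventBound_ne_top {z : ℂ} (hz : z.im ≠ 0) : resolventBound z ≠ ∞ :=
  ENNReal.mul_ne_top enorm_ne_top (lintegral_decayKernel_ne_top hz)

theorem exists_memLp_solution {z : ℂ} (hz : z.im ≠ 0) {g : ℝ → ℂ} (hg : Measurable g)
    (hg2 : MemLp g 2) :
    LocallyIntegrable (modulatedSource z g) ∧ ∃ H : ℝ → ℂ,
      (∀ a b, H b - H a = ∫ t in a..b, modulatedSource z g t) ∧
      eLpNorm (fun x => planeWave z x * H x) 2 volume ≤
        resolventBound z * eLpNorm g 2 volume := by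
  have hfin : ∫⁻ t, ‖g t‖ₑ ^ 2 ≠ ∞ := by
    intro htop
    have := hg2.2
    rw [eLpNorm_two_eq, htop] at this
    simp at this
  obtain ⟨hloc, H, hH, hle⟩ := exists_primitive_modulatedSource hz hg hfin
  refine ⟨hloc, H, hH, ?_⟩
  have hsq : ∫⁻ x, ‖planeWave z x * H x‖ₑ ^ 2 ≤ resolventBound z ^ 2 * ∫⁻ t, ‖g t‖ₑ ^ 2 := by
    calc ∫⁻ x, ‖planeWave z x * H x‖ₑ ^ 2
        ≤ ∫⁻ x, ‖(2 * Real.pi : ℂ)‖ₑ ^ 2 * (∫⁻ t, decayKernel z.im (x - t) * ‖g t‖ₑ) ^ 2 := by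
          refine lintegral_mono fun x => ?_
          rw [← mul_pow]
          gcongr
          exact hle x
      _ = ‖(2 * Real.pi : ℂ)‖ₑ ^ 2 * ∫⁻ x, (∫⁻ t, decayKernel z.im (x - t) * ‖g t‖ₑ) ^ 2 :=
          lintegral_const_mul' _ _ (ENNReal.pow_ne_top enorm_ne_top)
      _ ≤ ‖(2 * Real.pi : ℂ)‖ₑ ^ 2 * ((∫⁻ s, decayKernel z.im s) ^ 2 * ∫⁻ t, ‖g t‖ₑ ^ 2) := by
          gcongr
          exact lintegral_convolution_sq_le (measurable_decayKernel _) hg.enorm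
      _ = _ := by rw [resolventBound, mul_pow, mul_assoc]
  rw [eLpNorm_two_eq, eLpNorm_two_eq]
  calc (∫⁻ x, ‖planeWave z x * H x‖ₑ ^ 2) ^ (1 / 2 : ℝ)
      ≤ (resolventBound z ^ 2 * ∫⁻ t, ‖g t‖ₑ ^ 2) ^ (1 / 2 : ℝ) := by gcongr
    _ = _ := by
      rw [ENNReal.mul_rpow_of_nonneg _ _ (by norm_num), ← ENNReal.rpow_two, ← ENNReal.rpow_mul]
      norm_num

/-! ### Non-real points are in the resolvent set of the continuous part -/

/-- A function on the exterior domain, transplanted to the two unbounded components, with a weight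
on the right one. -/
def outerCut {m : ℕ} (α β : Fin (m + 1) → ℝ) (κ : ℂ) (g : ℝ → ℂ) (x : ℝ) : ℂ :=
  (Set.Iio (β 0)).indicator g x + κ * (Set.Ioi (α (Fin.last m))).indicator g x

section OuterCut

variable {m : ℕ} {α β : Fin (m + 1) → ℝ} {κ : ℂ} {g : ℝ → ℂ} {x : ℝ}

theorem outerCut_of_lt (h : Interlaced α β) (hx : x < β 0) : outerCut α β κ g x = g x := by
  have h1 : x ∉ Set.Ioi (α (Fin.last m)) := fun hx' =>
    absurd (hx.trans h.β_zero_lt_α_last) (not_lt.2 (le_of_lt hx'))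
  rw [outerCut, Set.indicator_of_mem (show x ∈ Set.Iio (β 0) from hx),
    Set.indicator_of_notMem h1, mul_zero, add_zero]

theorem outerCut_of_gt (h : Interlaced α β) (hx : α (Fin.last m) < x) :
    outerCut α β κ g x = κ * g x := by
  have h1 : x ∉ Set.Iio (β 0) := fun hx' =>
    absurd (h.β_zero_lt_α_last.trans hx) (not_lt.2 (le_of_lt hx'))
  rw [outerCut, Set.indicator_of_notMem h1,
    Set.indicator_of_mem (show x ∈ Set.Ioi (α (Fin.last m)) from hx), zero_add]

theorem outerCut_of_mem_Icc (hx : x ∈ Set.Icc (β 0) (α (Fin.last m))) :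
    outerCut α β κ g x = 0 := by
  rw [outerCut, Set.indicator_of_notMem (Set.notMem_Iio.2 hx.1),
    Set.indicator_of_notMem (Set.notMem_Ioi.2 hx.2), mul_zero, add_zero]

theorem measurable_outerCut (hg : Measurable g) : Measurable (outerCut α β κ g) :=
  (hg.indicator measurableSet_Iio).add ((hg.indicator measurableSet_Ioi).const_mul κ)

theorem norm_outerCut_le (h : Interlaced α β) (x : ℝ) :
    ‖outerCut α β κ g x‖ ≤ (1 + ‖κ‖) * ‖(exteriorDomain α β).indicator g x‖ := by
  rcases lt_or_ge x (β 0) with hx | hx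
  · rw [outerCut_of_lt h hx, Set.indicator_of_mem (h.Iio_subset hx)]
    nlinarith [norm_nonneg κ, norm_nonneg (g x), mul_nonneg (norm_nonneg κ) (norm_nonneg (g x))]
  rcases lt_or_ge (α (Fin.last m)) x with hx' | hx'
  · rw [outerCut_of_gt h hx', Set.indicator_of_mem (h.Ioi_subset hx'), norm_mul]
    nlinarith [norm_nonneg (g x)]
  · rw [outerCut_of_mem_Icc ⟨hx, hx'⟩, norm_zero]
    positivity

theorem eLpNorm_outerCut_le (h : Interlaced α β) :
    eLpNorm (outerCut α β κ g) 2 volume ≤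
      ENNReal.ofReal (1 + ‖κ‖) * eLpNorm g 2 (volume.restrict (exteriorDomain α β)) := by
  rw [← eLpNorm_indicator_eq_eLpNorm_restrict (isOpen_exteriorDomain α β).measurableSet]
  exact eLpNorm_le_mul_eLpNorm_of_ae_le_mul (Eventually.of_forall (norm_outerCut_le h)) 2

end OuterCut

/-- The representative glued from a function `G` on the left unbounded component, the multiple
`κ * G` on the right one, and `0` on the bounded components. -/
def outerGlue {m : ℕ} (α β : Fin (m + 1) → ℝ) (κ : ℂ) (G : ℝ → ℂ) (x : ℝ) : ℂ :=
  (Set.Iic (β 0)).indicator G x + κ * (Set.Ici (α (Fin.last m))).indicator G x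

section OuterGlue

variable {m : ℕ} {α β : Fin (m + 1) → ℝ} {κ : ℂ} {G : ℝ → ℂ} {x : ℝ}

theorem outerGlue_of_le (h : Interlaced α β) (hx : x ≤ β 0) : outerGlue α β κ G x = G x := by
  have h1 : x ∉ Set.Ici (α (Fin.last m)) := fun hx' =>
    absurd (hx.trans_lt h.β_zero_lt_α_last) (not_lt.2 hx')
  rw [outerGlue, Set.indicator_of_mem (show x ∈ Set.Iic (β 0) from hx),
    Set.indicator_of_notMem h1, mul_zero, add_zero]

theorem outerGlue_of_ge (h : Interlaced α β) (hx : α (Fin.last m) ≤ x) :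
    outerGlue α β κ G x = κ * G x := by
  have h1 : x ∉ Set.Iic (β 0) := fun hx' =>
    absurd (h.β_zero_lt_α_last.trans_le hx) (not_lt.2 hx')
  rw [outerGlue, Set.indicator_of_notMem h1,
    Set.indicator_of_mem (show x ∈ Set.Ici (α (Fin.last m)) from hx), zero_add]

theorem outerGlue_of_mem_Ioo (hx : x ∈ Set.Ioo (β 0) (α (Fin.last m))) :
    outerGlue α β κ G x = 0 := by
  rw [outerGlue, Set.indicator_of_notMem (Set.notMem_Iic.2 hx.1),
    Set.indicator_of_notMem (Set.notMem_Ici.2 hx.2), mul_zero, add_zero]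

theorem measurable_outerGlue (hG : Measurable G) : Measurable (outerGlue α β κ G) :=
  (hG.indicator measurableSet_Iic).add ((hG.indicator measurableSet_Ici).const_mul κ)

theorem norm_outerGlue_le (h : Interlaced α β) (x : ℝ) :
    ‖outerGlue α β κ G x‖ ≤ (1 + ‖κ‖) * ‖G x‖ := by
  rcases le_or_gt x (β 0) with hx | hx
  · rw [outerGlue_of_le h hx]
    nlinarith [norm_nonneg κ, norm_nonneg (G x), mul_nonneg (norm_nonneg κ) (norm_nonneg (G x))]
  rcases le_or_gt (α (Fin.last m)) x with hx' | hx'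
  · rw [outerGlue_of_ge h hx', norm_mul]
    nlinarith [norm_nonneg (G x)]
  · rw [outerGlue_of_mem_Ioo ⟨hx, hx'⟩, norm_zero]
    positivity

end OuterGlue

theorem Interlaced.Icc_gap_subset {m : ℕ} {α β : Fin (m + 1) → ℝ} (h : Interlaced α β)
    (k : Fin m) : Set.Icc (α k.castSucc) (β k.succ) ⊆ Set.Ioo (β 0) (α (Fin.last m)) :=
  fun _ hx => ⟨(h.β_zero_lt_α _).trans_le hx.1, hx.2.trans_lt (h.β_lt_α_last _)⟩

/-- For non-real `z`, the equation `(P - z) f = g` with `g` in the continuous subspace has a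
solution in the continuous subspace, with a bound. -/
theorem exists_solution_continuousSubspace {m : ℕ} {α β : Fin (m + 1) → ℝ} (h : Interlaced α β)
    {c : ℂ} (hc : ‖c‖ = 1) {z : ℂ} (hz : z.im ≠ 0) :
    ∃ C : ℝ, ∀ g ∈ continuousSubspace (momentumOperator α β (decouplingMatrix m c)),
      ∃ f ∈ continuousSubspace (momentumOperator α β (decouplingMatrix m c)),
        (f, g + z • f) ∈ (momentumOperator α β (decouplingMatrix m c)).graph ∧
          ‖f‖ ≤ C * ‖g‖ := by
  have hc0 : c ≠ 0 := by
    rintro rfl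
    simp at hc
  -- The source is cut to zero on `[β 0, α (Fin.last m)]`, so the whole-line solution `G` evolves
  -- freely there and gains the factor `planeWave z (α (Fin.last m) - β 0)`. This `κ` cancels that
  -- factor and inserts `c`, so that `κ * G (α (Fin.last m)) = c * G (β 0)`. The source on the right
  -- carries `κ⁻¹` so that `κ * G` solves the equation with source `g`.
  obtain ⟨κ, hκ⟩ : ∃ κ : ℂ, κ = c * planeWave (-z) (α (Fin.last m) - β 0) := ⟨_, rfl⟩
  have hκ0 : κ ≠ 0 := hκ ▸ mul_ne_zero hc0 (planeWave_ne_zero _ _)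
  refine ⟨(1 + ‖κ‖) * ((resolventBound z).toReal * (1 + ‖κ⁻¹‖)), fun g hg => ?_⟩
  rw [mem_continuousSubspace_iff h hc] at hg
  have hgm : Measurable g := (Lp.stronglyMeasurable g).measurable
  have hcut := measurable_outerCut (α := α) (β := β) (κ := κ⁻¹) hgm
  have hcutle := eLpNorm_outerCut_le (κ := κ⁻¹) (g := g) h
  have hcutL : MemLp (outerCut α β κ⁻¹ g) 2 volume :=
    ⟨hcut.aestronglyMeasurable, hcutle.trans_lt
      (ENNReal.mul_lt_top ENNReal.ofReal_lt_top (Lp.memLp g).2)⟩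
  obtain ⟨hloc, H, hH, hHle⟩ := exists_memLp_solution hz hcut hcutL
  have hHac := absolutelyContinuousOnInterval_of_primitive hloc hH
  have hHcont : Continuous H := continuous_iff_continuousAt.2 fun x => by
    have := (hHac (x - 1) (x + 1)).continuousOn
    rw [Set.uIcc_of_le (by linarith)] at this
    exact this.continuousAt (Icc_mem_nhds (by linarith) (by linarith))
  obtain ⟨G, hGdef⟩ : ∃ G : ℝ → ℂ, G = fun x => planeWave z x * H x := ⟨_, rfl⟩
  have hGac : ∀ a b, AbsolutelyContinuousOnInterval G a b := fun a b => by
    rw [hGdef]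
    exact ((contDiff_planeWave z).absolutelyContinuousOnInterval a b).smul (hHac a b)
  have hGm : Measurable G := hGdef ▸ ((continuous_planeWave z).mul hHcont).measurable
  have hGd : ∀ᵐ x, HasDerivAt G
      (2 * Real.pi * Complex.I * (outerCut α β κ⁻¹ g x + z * G x)) x := by
    filter_upwards [ae_hasDerivAt_of_primitive hloc hH] with x hx
    have h1 := (hasDerivAt_planeWave z x).mul hx
    have e : 2 * Real.pi * Complex.I * z * planeWave z x * H x +
        planeWave z x * modulatedSource z (outerCut α β κ⁻¹ g) x =
        2 * Real.pi * Complex.I * (outerCut α β κ⁻¹ g x + z * (planeWave z x * H x)) := by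
      simp only [modulatedSource]
      linear_combination (2 * Real.pi * Complex.I * outerCut α β κ⁻¹ g x) * planeWave_neg_mul z x
    rw [e] at h1
    rw [hGdef]
    exact h1
  have hle : eLpNorm (outerGlue α β κ G) 2 (volume.restrict (exteriorDomain α β)) ≤
      ENNReal.ofReal (1 + ‖κ‖) * (resolventBound z * (ENNReal.ofReal (1 + ‖κ⁻¹‖) *
        eLpNorm g 2 (volume.restrict (exteriorDomain α β)))) := by
    refine (eLpNorm_mono_measure _ Measure.restrict_le_self).trans ?_
    refine (eLpNorm_le_mul_eLpNorm_of_ae_le_mul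
      (Eventually.of_forall (norm_outerGlue_le (G := G) h)) 2).trans ?_
    rw [hGdef]
    gcongr
    exact hHle.trans (by gcongr)
  have hfin : ENNReal.ofReal (1 + ‖κ‖) * (resolventBound z * (ENNReal.ofReal (1 + ‖κ⁻¹‖) *
        eLpNorm g 2 (volume.restrict (exteriorDomain α β)))) ≠ ∞ :=
    ENNReal.mul_ne_top ENNReal.ofReal_ne_top (ENNReal.mul_ne_top (resolventBound_ne_top hz)
      (ENNReal.mul_ne_top ENNReal.ofReal_ne_top (Lp.memLp g).2.ne))
  have hFL : MemLp (outerGlue α β κ G) 2 (volume.restrict (exteriorDomain α β)) :=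
    ⟨(measurable_outerGlue hGm).aestronglyMeasurable, hle.trans_lt hfin.lt_top⟩
  refine ⟨hFL.toLp, ?_, ?_, ?_⟩
  · rw [mem_continuousSubspace_iff h hc]
    intro k
    filter_upwards [ae_mono (Measure.restrict_mono (h.gap_subset k) le_rfl) hFL.coeFn_toLp,
      ae_restrict_mem measurableSet_Ioo] with x hx hmem
    rw [hx, outerGlue_of_mem_Ioo (h.Icc_gap_subset k (Set.Ioo_subset_Icc_self hmem))]
  · rw [mem_graph_momentumOperator_iff]
    have hac0 : ∀ a b, AbsolutelyContinuousOnInterval (fun _ : ℝ => (0 : ℂ)) a b :=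
      (contDiff_const (n := 1)).absolutelyContinuousOnInterval
    refine ⟨_, hFL.coeFn_toLp.symm, ?_, ?_, fun k => ?_, ?_⟩
    · exact h.absolutelyContinuousOnInterval_of_pieces (M := fun _ _ => 0) hGac
        (fun a b => (hGac a b).const_smul κ) (fun _ => hac0)
        (fun x hx => (outerGlue_of_le h hx).symm) (fun x hx => (outerGlue_of_ge h hx).symm)
        (fun k x hx => (outerGlue_of_mem_Ioo (h.Icc_gap_subset k hx)).symm)
    · have hgap : ∀ᵐ x, ∀ k : Fin m, x ∈ Set.Ioo (α k.castSucc) (β k.succ) → g x = 0 := by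
        rw [ae_all_iff]
        exact fun k => (ae_restrict_iff' measurableSet_Ioo).1 (hg k)
      rw [ae_restrict_iff' (isOpen_exteriorDomain α β).measurableSet]
      filter_upwards [hgap, hGd] with x hx0 hx hmem
      rcases mem_pieces_of_mem_exteriorDomain hmem with hp | hp | ⟨k, hp⟩
      · rw [outerGlue_of_le h hp.le]
        rw [outerCut_of_lt h hp] at hx
        refine hx.congr_of_eventuallyEq ?_
        filter_upwards [Iio_mem_nhds hp] with y hy using outerGlue_of_le h (le_of_lt hy)
      · rw [outerGlue_of_ge h hp.le]
        rw [outerCut_of_gt h hp] at hx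
        have h1 := hx.const_mul κ
        have e : κ * (2 * Real.pi * Complex.I * (κ⁻¹ * g x + z * G x)) =
            2 * Real.pi * Complex.I * (g x + z * (κ * G x)) := by
          field_simp
        rw [e] at h1
        refine h1.congr_of_eventuallyEq ?_
        filter_upwards [Ioi_mem_nhds hp] with y hy using outerGlue_of_ge h (le_of_lt hy)
      · have hz0 : ∀ y ∈ Set.Ioo (α k.castSucc) (β k.succ), outerGlue α β κ G y = 0 := fun y hy =>
          outerGlue_of_mem_Ioo (h.Icc_gap_subset k (Set.Ioo_subset_Icc_self hy))
        rw [hx0 k hp, hz0 x hp, mul_zero, add_zero, mul_zero]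
        refine (hasDerivAt_const x (0 : ℂ)).congr_of_eventuallyEq ?_
        filter_upwards [Ioo_mem_nhds hp.1 hp.2] with y hy using hz0 y hy
    · rw [outerGlue_of_mem_Ioo (h.Icc_gap_subset k (Set.right_mem_Icc.2 (h.α_lt_β_succ k).le)),
        outerGlue_of_mem_Ioo (h.Icc_gap_subset k (Set.left_mem_Icc.2 (h.α_lt_β_succ k).le))]
    · rw [outerGlue_of_le h le_rfl, outerGlue_of_ge h le_rfl]
      -- The source of `H` vanishes between the two half-lines.
      have h0 : H (α (Fin.last m)) = H (β 0) := by
        rw [← sub_eq_zero, hH]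
        refine intervalIntegral.integral_zero_ae (Eventually.of_forall fun t ht => ?_)
        rw [Set.uIoc_of_le h.β_zero_lt_α_last.le] at ht
        rw [modulatedSource, outerCut_of_mem_Icc ⟨ht.1.le, ht.2⟩, mul_zero, mul_zero]
      have h1 : planeWave z (α (Fin.last m)) =
          planeWave z (α (Fin.last m) - β 0) * planeWave z (β 0) := by
        rw [← planeWave_add, sub_add_cancel]
      simp only [hGdef]
      rw [h0, h1, hκ]
      linear_combination -(c * planeWave z (β 0) * H (β 0)) *
        planeWave_neg_mul z (α (Fin.last m) - β 0)
  · rw [Lp.norm_toLp, Lp.norm_def]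
    refine (ENNReal.toReal_mono hfin hle).trans_eq ?_
    rw [ENNReal.toReal_mul, ENNReal.toReal_mul, ENNReal.toReal_mul,
      ENNReal.toReal_ofReal (by positivity), ENNReal.toReal_ofReal (by positivity)]
    ring

/-- Injectivity holds because no non-real number is an eigenvalue of the full operator. -/
theorem mem_resolventSetOf_of_im_ne_zero {m : ℕ} {α β : Fin (m + 1) → ℝ} (h : Interlaced α β)
    {c : ℂ} (hc : ‖c‖ = 1) {z : ℂ} (hz : z.im ≠ 0) :
    z ∈ resolventSetOf (partIn (momentumOperator α β (decouplingMatrix m c))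
      (continuousSubspace (momentumOperator α β (decouplingMatrix m c)))) := by
  obtain ⟨C, hC⟩ := exists_solution_continuousSubspace h hc hz
  refine mem_resolventSetOf_of_bound C (fun f hf => ?_) fun g => ?_
  · rw [mem_graph_partIn_iff] at hf
    have hmem : (f : L2Ext α β) ∈
        eigenspaceOf (momentumOperator α β (decouplingMatrix m c)) z := hf
    rw [eigenspaceOf_momentumOperator_eq_bot h hc hz] at hmem
    exact Subtype.ext hmem
  · obtain ⟨f, hf, hgraph, hle⟩ := hC g g.2
    exact ⟨⟨f, hf⟩, (mem_graph_partIn_iff _ _ _ _).2 hgraph, hle⟩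

theorem continuousSpectrumOf_momentumOperator {m : ℕ} {α β : Fin (m + 1) → ℝ}
    (h : Interlaced α β) {c : ℂ} (hc : ‖c‖ = 1) :
    continuousSpectrumOf (momentumOperator α β (decouplingMatrix m c)) =
      Set.range (fun t : ℝ => (t : ℂ)) := by
  refine Set.Subset.antisymm (fun z hz => ?_) ?_
  · by_contra hne
    refine hz (mem_resolventSetOf_of_im_ne_zero h hc fun him => hne ⟨z.re, ?_⟩)
    exact Complex.ext rfl him.symm
  · rintro _ ⟨t, rfl⟩
    exact ofReal_notMem_resolventSetOf h hc t

end

/-! ### The main theorem -/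

theorem theorem3p21 (m : ℕ) (hm : 0 < m) (α β : Fin (m + 1) → ℝ)
    (hβα : ∀ i, β i < α i) (hαβ : ∀ k : Fin m, α k.castSucc < β k.succ)
    (c : ℂ) (hc : ‖c‖ = 1) :
    -- the continuous spectrum is the real line
    continuousSpectrumOf (momentumOperator α β (decouplingMatrix m c)) =
        Set.range (fun t : ℝ => (t : ℂ)) ∧
    -- the set of eigenvalues is the union of the sets `(1 / ℓ k) ℤ`
    pointSpectrumOf (momentumOperator α β (decouplingMatrix m c)) =
        (fun t : ℝ => (t : ℂ)) '' (⋃ k : Fin m,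
          Set.range fun j : ℤ => 1 / gapLength α β k * (j : ℝ)) ∧
    -- the multiplicity of `t` is the number of `k` with `ℓ k * t ∈ ℤ`
    (∀ t : ℝ, eigenMultiplicity (momentumOperator α β (decouplingMatrix m c)) (t : ℂ) =
        {k : Fin m | ∃ j : ℤ, gapLength α β k * t = (j : ℝ)}.encard) ∧
    -- `0` is an eigenvalue of multiplicity `n - 1 = m`
    ((0 : ℂ) ∈ pointSpectrumOf (momentumOperator α β (decouplingMatrix m c)) ∧
      eigenMultiplicity (momentumOperator α β (decouplingMatrix m c)) 0 = (m : ℕ∞)) ∧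
    -- counted with multiplicity, the eigenvalues have density `∑ k, ℓ k`
    (∀ a : ℝ, Tendsto
      (fun R : ℝ =>
        eigenvalueCount (momentumOperator α β (decouplingMatrix m c)) (a - R) (a + R) /
          ENNReal.ofReal (2 * R))
      atTop (𝓝 (ENNReal.ofReal (∑ k : Fin m, gapLength α β k)))) := by
  have h : Interlaced α β := ⟨hβα, hαβ⟩
  refine ⟨continuousSpectrumOf_momentumOperator h hc, pointSpectrumOf_momentumOperator h hc,
    eigenMultiplicity_momentumOperator_ofReal h hc, ⟨?_, ?_⟩,
    tendsto_eigenvalueCount_momentumOperator h hc⟩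
  · exact (mem_pointSpectrumOf_momentumOperator_iff h hc 0).2 ⟨⟨0, hm⟩, 0, by simp⟩
  · have huniv : {k : Fin m | ∃ j : ℤ, (gapLength α β k : ℂ) * 0 = j} = Set.univ :=
      Set.eq_univ_of_forall fun k => ⟨0, by simp⟩
    rw [eigenMultiplicity_momentumOperator h hc, huniv, Set.encard_univ]
    simp
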